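/- Let $\mathbb{F}_q$ be a finite field with $q$ elements, let $d\ge 1$, and let $\mathbb{F}_{q^d}$ be its extension of degree $d$. Let $\mathbb{F}_{q^d}\{\tau\}$ be the ring of skew polynomials $\sum_i a_i\tau^i$ ($a_i\in\mathbb{F}_{q^d}$) with $\tau\lambda=\lambda^q\tau$, regarded as an algebra over its central subring $\mathbb{F}_q[t]$, $t=\tau^d$. Let $p=p(t)\in\mathbb{F}_q[t]$ be an irreducible polynomial not divisible by $t$, let $\mathbb{F}_q(t)_p$ be the completion of $\mathbb{F}_q(t)$ at $p$, and let $\mathbb{F}_q[t]_p$ be its valuation ring. Put $$\mathbb{F}_{q^d}\{\tau\}[\tfrac1p]=\mathbb{F}_q[t][\tfrac1p]\otimes_{\mathbb{F}_q[t]}\mathbb{F}_{q^d}\{\tau\},\qquad \Gamma(1)=\bigl(\mathbb{F}_{q^d}\{\tau\}[\tfrac1p]\bigr)^\times/Z,\qquad Z=\bigl(\mathbb{F}_q[t][\tfrac1p]\bigr)^\times,$$ and let $\Gamma(\tau)$ be the kernel of the homomorphism $\Gamma(1)\to\mathbb{F}_{q^d}^\times/\mathbb{F}_q^\times$ induced by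 evaluation at $\tau=0$. Then there is an isomorphism of $\mathbb{F}_q(t)_p$-algebras $\varphi:\mathbb{F}_q(t)_p\otimes_{\mathbb{F}_q[t]}\mathbb{F}_{q^d}\{\tau\}\to M(d;\mathbb{F}_q(t)_p)$ which maps $\mathbb{F}_q[t]_p\otimes_{\mathbb{F}_q[t]}\mathbb{F}_{q^d}\{\tau\}$ onto $M(d;\mathbb{F}_q[t]_p)$. For every such $\varphi$, let $\Gamma(1)$ act through $\varphi$ on the vertex set $X_0(\mathbb{F}_q(t)_p^d)$ of the Bruhat–Tits building of $\mathrm{PGL}(d,\mathbb{F}_q(t)_p)$, that is, on the set of $\mathbb{F}_q[t]_p$-lattices in $\mathbb{F}_q(t)_p^d$ up to multiplication by scalars from $\mathbb{F}_q(t)_p^\times$. Then $\Gamma(\tau)$ acts simply transitively on $X_0(\mathbb{F}_q(t)_p^d)$: for any two vertices $x,y$ there is exactly one $\gamma\in\Gamma(\tau)$ with $\gamma x=y$. -/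

import Mathlib

open Polynomial TensorProduct
open scoped Pointwise

noncomputable section

namespace SkewBuilding

/-! ## The skew polynomial ring `K{τ}` with `τ a = a ^ q τ`, where `q = #k` -/

section SkewPolynomials

variable (k K : Type*) [Field k] [Fintype k] [Field K] [Algebra k K]

/-- A copy of the field `K`, on which `Multiplicative ℕ` acts through the Frobenius endomorphism
`a ↦ a ^ q`, `q = #k`. -/
def FrobField (_k K : Type*) : Type _ := K

instance : Field (FrobField k K) := inferInstanceAs (Field K)

instance : Algebra k (FrobField k K) := inferInstanceAs (Algebra k K)

instance [FiniteDimensional k K] : FiniteDimensional k (FrobField k K) :=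
  inferInstanceAs (FiniteDimensional k K)

/-- The generator of `Multiplicative ℕ` acts as `a ↦ a ^ q`. -/
instance : MulSemiringAction (Multiplicative ℕ) (FrobField k K) :=
  MulSemiringAction.compHom (FrobField k K)
    (powersHom (FrobField k K →+* FrobField k K)
      (FiniteField.frobeniusAlgHom k (FrobField k K) : FrobField k K →+* FrobField k K))

theorem phi_apply (a : FrobField k K) :
    (SkewPolynomial.φ : FrobField k K →+* FrobField k K) a = a ^ Fintype.card k := by
  change (powersHom (FrobField k K →+* FrobField k K)
    (FiniteField.frobeniusAlgHom k (FrobField k K) : FrobField k K →+* FrobField k K)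
      (Multiplicative.ofAdd 1)) a = _
  simp [powersHom_apply]

/-- The ring `K{τ}` of skew polynomials `∑ aᵢ τ ^ i`, `aᵢ ∈ K`, with `τ a = a ^ q τ`. -/
abbrev SkewPoly : Type _ := SkewPolynomial (FrobField k K)

/-- Constants `K → K{τ}`. -/
def const : FrobField k K →+* SkewPoly k K := SkewPolynomial.CRingHom

/-- The indeterminate `τ`. -/
def tau : SkewPoly k K := SkewPolynomial.X

theorem tau_mul_const (a : FrobField k K) :
    tau k K * const k K a = const k K (a ^ Fintype.card k) * tau k K := by
  change SkewPolynomial.X * SkewPolynomial.C a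
    = SkewPolynomial.C (a ^ Fintype.card k) * SkewPolynomial.X
  rw [← SkewPolynomial.monomial_zero_left, SkewPolynomial.X_mul_monomial, phi_apply,
    ← SkewPolynomial.monomial_zero_left, SkewPolynomial.monomial_mul_X]

theorem tau_pow_mul_const (n : ℕ) (a : FrobField k K) :
    tau k K ^ n * const k K a = const k K (a ^ Fintype.card k ^ n) * tau k K ^ n := by
  induction n generalizing a with
  | zero => simp
  | succ n ih =>
    rw [pow_succ, mul_assoc, tau_mul_const, ← mul_assoc, ih, mul_assoc, ← pow_mul, pow_succ']

theorem const_algebraMap_commute_tau (a : k) (n : ℕ) :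
    Commute (const k K (algebraMap k _ a)) (tau k K ^ n) := by
  have h : (algebraMap k (FrobField k K) a) ^ Fintype.card k ^ n = algebraMap k _ a := by
    rw [← map_pow, FiniteField.pow_card_pow]
  have := tau_pow_mul_const k K n (algebraMap k _ a)
  rw [h] at this
  exact this.symm

theorem skewPoly_induction {P : SkewPoly k K → Prop}
    (add : ∀ f g, P f → P g → P (f + g))
    (mono : ∀ a n, P (const k K a * tau k K ^ n)) (f : SkewPoly k K) : P f := by
  have hm : ∀ (n : ℕ) (a : FrobField k K), P (SkewPolynomial.monomial n a) := by
    intro n a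
    rw [← SkewPolynomial.C_mul_X_pow_eq_monomial]
    exact mono a n
  refine SkewPolynomial.induction f ?_ ?_
  · simpa using hm 0 0
  · intro n r g _ _ hg
    exact add _ _ (hm n r) hg

theorem pow_card_pow_finrank [FiniteDimensional k K] (a : FrobField k K) :
    a ^ Fintype.card k ^ Module.finrank k K = a := by
  have := Module.finite_of_finite k (M := FrobField k K)
  have := Fintype.ofFinite (FrobField k K)
  have h : Fintype.card (FrobField k K) = Fintype.card k ^ Module.finrank k K :=
    Module.card_eq_pow_finrank (K := k) (V := FrobField k K)
  rw [← h, FiniteField.pow_card]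

/-- The ring homomorphism `k[t] → K{τ}` with `t ↦ τ ^ d`, `d = [K : k]`. -/
def centerHom : k[X] →+* SkewPoly k K :=
  Polynomial.eval₂RingHom' ((const k K).comp (algebraMap k (FrobField k K)))
    (tau k K ^ Module.finrank k K) (fun a => const_algebraMap_commute_tau k K a _)

theorem centerHom_monomial (m : ℕ) (c : k) : centerHom k K (monomial m c)
    = const k K (algebraMap k _ c) * (tau k K ^ Module.finrank k K) ^ m := by
  simp [centerHom]

theorem centerHom_commute [FiniteDimensional k K] (f : k[X]) (x : SkewPoly k K) :
    Commute (centerHom k K f) x := by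
  induction x using skewPoly_induction k K with
  | add x y hx hy => exact hx.add_right hy
  | mono a n =>
    induction f using Polynomial.induction_on' with
    | add f g hf hg => rw [map_add]; exact hf.add_left hg
    | monomial m c =>
      have h2 : Commute (const k K (algebraMap k _ c)) (const k K a) := by
        rw [Commute, SemiconjBy, ← map_mul, ← map_mul, mul_comm]
      have h3 : Commute (tau k K ^ Module.finrank k K) (const k K a) := by
        rw [Commute, SemiconjBy, tau_pow_mul_const, pow_card_pow_finrank]
      have h4 : Commute (tau k K ^ Module.finrank k K) (tau k K ^ n) := Commute.pow_pow_self _ _ _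
      rw [centerHom_monomial]
      exact Commute.mul_left (h2.mul_right (const_algebraMap_commute_tau k K c n))
        ((h3.mul_right h4).pow_left m)

/-- `K{τ}` as an algebra over its central subring `k[t]`, `t = τ ^ d`. -/
instance [FiniteDimensional k K] : Algebra k[X] (SkewPoly k K) :=
  (centerHom k K).toAlgebra' (fun f x => centerHom_commute k K f x)

theorem algebraMap_X [FiniteDimensional k K] :
    algebraMap k[X] (SkewPoly k K) X = tau k K ^ Module.finrank k K := by
  change centerHom k K X = _
  simp [centerHom]

/-- Evaluation at `τ = 0`: the constant coefficient, as a ring homomorphism `K{τ} → K`. -/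
def constCoeff : SkewPoly k K →+* K where
  toFun f := f.coeff 0
  map_zero' := rfl
  map_one' := SkewPolynomial.coeff_one_zero
  map_add' f g := by
    change (f + g).coeff 0 = f.coeff 0 + g.coeff 0
    simp
  map_mul' f g := by
    change (f * g).coeff 0 = f.coeff 0 * g.coeff 0
    induction f using skewPoly_induction k K with
    | add f₁ f₂ h₁ h₂ => simp only [add_mul, SkewPolynomial.coeff_add, h₁, h₂]
    | mono a n =>
      induction g using skewPoly_induction k K with
      | add g₁ g₂ h₁ h₂ => simp only [mul_add, SkewPolynomial.coeff_add, h₁, h₂]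
      | mono b m =>
        have e : ∀ c l, const k K c * tau k K ^ l = SkewPolynomial.monomial l c :=
          fun c l => by
            rw [← SkewPolynomial.C_mul_X_pow_eq_monomial]
            rfl
        rw [e, e, SkewPolynomial.monomial_mul_monomial]
        rcases n with _ | n <;> rcases m with _ | m <;> simp [SkewPolynomial.coeff_monomial]

theorem constCoeff_algebraMap [FiniteDimensional k K] (f : k[X]) :
    constCoeff k K (algebraMap k[X] (SkewPoly k K) f) = algebraMap k K (f.eval 0) := by
  have hd : Module.finrank k K ≠ 0 := Module.finrank_pos.ne'
  have hc : ∀ a, constCoeff k K (const k K a) = a := fun a => SkewPolynomial.coeff_C_zero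
  have ht : constCoeff k K (tau k K) = 0 := SkewPolynomial.coeff_X_zero
  change constCoeff k K (centerHom k K f) = _
  induction f using Polynomial.induction_on' with
  | add f g hf hg => simp [hf, hg]
  | monomial m c =>
    rw [centerHom_monomial, map_mul, map_pow, map_pow, hc, ht, zero_pow hd, eval_monomial, map_mul,
      map_pow, map_zero]
    rfl

end SkewPolynomials

/-! ## The arithmetic groups `Γ(1)` and `Γ(τ)` -/

section ArithmeticGroups

theorem isUnit_eval_zero {k : Type*} [Field k] {p : k[X]} (hpt : ¬ X ∣ p) :
    IsUnit (Polynomial.evalRingHom (0 : k) p) := by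
  rw [isUnit_iff_ne_zero, coe_evalRingHom, ← Polynomial.coeff_zero_eq_eval_zero]
  rwa [Polynomial.X_dvd_iff] at hpt

/-- Evaluation at `t = 0` on `k[t][1/p]`, for `p` prime to `t`. -/
def awayEval {k : Type*} [Field k] {p : k[X]} (hpt : ¬ X ∣ p) : Localization.Away p →+* k :=
  IsLocalization.Away.lift p (isUnit_eval_zero hpt)

variable (k K : Type*) [Field k] [Fintype k] [Field K] [Algebra k K] [FiniteDimensional k K]

/-- The ring `B ⊗ K{τ}` over `k[t]`, for a commutative `k[t]`-algebra `B`. -/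
abbrev Order (B : Type*) [CommRing B] [Algebra k[X] B] : Type _ := B ⊗[k[X]] SkewPoly k K

variable (p : k[X])

/-- `K{τ}[1/p] = k[t][1/p] ⊗ K{τ}`. -/
abbrev OrderAway : Type _ := Order k K (Localization.Away p)

/-- The subgroup `Z = k[t][1/p]ˣ` of scalars in the unit group of `K{τ}[1/p]`. -/
def scalarUnits : Subgroup (OrderAway k K p)ˣ :=
  (Units.map (algebraMap (Localization.Away p) (OrderAway k K p)).toMonoidHom).range

instance : (scalarUnits k K p).Normal where
  conj_mem := by
    rintro _ ⟨z, rfl⟩ g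
    refine ⟨z, ?_⟩
    ext
    have h := Algebra.commutes (z : Localization.Away p) (g : OrderAway k K p)
    simp only [Units.val_mul, RingHom.toMonoidHom_eq_coe, Units.coe_map, MonoidHom.coe_coe]
    rw [← h, mul_assoc, Units.mul_inv, mul_one]

/-- `Γ(1) = K{τ}[1/p]ˣ / Z`. -/
abbrev GammaOne : Type _ := (OrderAway k K p)ˣ ⧸ scalarUnits k K p

variable {p}

/-- Evaluation at `τ = 0` on `K{τ}[1/p]`, for `p` prime to `t`: the ring homomorphism which sends
`f ⊗ g` to `f(0)` times the constant coefficient of `g`. -/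
def evalTauZero (hpt : ¬ X ∣ p) : OrderAway k K p →+* K :=
  letI : Algebra k[X] K := ((algebraMap k K).comp (Polynomial.evalRingHom 0)).toAlgebra
  (Algebra.TensorProduct.lift (R := k[X]) (S := k[X])
    (⟨(algebraMap k K).comp (awayEval hpt), fun f => by
      change algebraMap k K (awayEval hpt (algebraMap _ _ f)) = _
      rw [awayEval, IsLocalization.Away.lift_eq]; rfl⟩ : Localization.Away p →ₐ[k[X]] K)
    (⟨constCoeff k K, fun f => constCoeff_algebraMap k K f⟩ : SkewPoly k K →ₐ[k[X]] K)
    (fun _ _ => Commute.all _ _)).toRingHom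

theorem evalTauZero_tmul (hpt : ¬ X ∣ p) (f : Localization.Away p) (g : SkewPoly k K) :
    evalTauZero k K hpt (f ⊗ₜ g) = algebraMap k K (awayEval hpt f) * constCoeff k K g := rfl

/-- The subgroup `kˣ` of `Kˣ`. -/
def baseUnits : Subgroup Kˣ := (Units.map (algebraMap k K).toMonoidHom).range

/-- The homomorphism `Γ(1) → Kˣ / kˣ` induced by evaluation at `τ = 0`. -/
def gammaEval (hpt : ¬ X ∣ p) : GammaOne k K p →* Kˣ ⧸ baseUnits k K :=
  QuotientGroup.map _ _ (Units.map (evalTauZero k K hpt).toMonoidHom) (by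
    rintro _ ⟨z, rfl⟩
    refine ⟨Units.map (awayEval hpt).toMonoidHom z, ?_⟩
    ext
    change algebraMap k K (awayEval hpt z) = evalTauZero k K hpt ((z : Localization.Away p) ⊗ₜ 1)
    rw [evalTauZero_tmul, map_one, mul_one])

/-- `Γ(τ)`, the kernel of `Γ(1) → Kˣ / kˣ`. -/
def GammaTau (hpt : ¬ X ∣ p) : Subgroup (GammaOne k K p) := (gammaEval k K hpt).ker

end ArithmeticGroups

/-! ## Lattices and the vertices of the affine building of `PGL(d, F)` -/

section Lattices

variable (O F : Type*) [CommRing O] [Field F] [Algebra O F] (d : ℕ)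

/-- An `O`-submodule of `F ^ d` is a lattice if it is spanned over `O` by an `F`-basis. -/
def IsLattice (L : Submodule O (Fin d → F)) : Prop :=
  ∃ b : Module.Basis (Fin d) F (Fin d → F), L = Submodule.span O (Set.range b)

/-- The set of lattices in `F ^ d`. -/
def Lattice : Type _ := {L : Submodule O (Fin d → F) // IsLattice O F d L}

variable {F d} in
/-- Left multiplication by `g ∈ GL(d, F)`, as an `O`-linear map of `F ^ d`. -/
def glMap (g : GL (Fin d) F) : (Fin d → F) →ₗ[O] (Fin d → F) :=
  (Matrix.mulVecLin (g : Matrix (Fin d) (Fin d) F)).restrictScalars O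

/-- The action `g L = {g l | l ∈ L}` of `GL(d, F)` on lattices. -/
instance : MulAction (GL (Fin d) F) (Lattice O F d) where
  smul g L := ⟨L.1.map (glMap O g), by
    obtain ⟨b, hb⟩ := L.2
    refine ⟨b.map (Matrix.GeneralLinearGroup.toLin g).toLinearEquiv, ?_⟩
    rw [hb, Submodule.map_span, ← Set.range_comp]
    rfl⟩
  one_smul L := Subtype.ext <| by
    change L.1.map (glMap O 1) = L.1
    have : glMap O (1 : GL (Fin d) F) = LinearMap.id := by
      ext1 v
      simp [glMap]
    rw [this, Submodule.map_id]
  mul_smul g h L := Subtype.ext <| by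
    change L.1.map (glMap O (g * h)) = (L.1.map (glMap O h)).map (glMap O g)
    rw [← Submodule.map_comp]
    congr 1
    ext1 v
    simp [glMap]

/-- Similarity of lattices: `L' = c L` for some `c ∈ Fˣ`. -/
instance latticeSetoid : Setoid (Lattice O F d) where
  r L L' := ∃ c : Fˣ, L'.1 = (c : F) • L.1
  iseqv :=
    { refl := fun L => ⟨1, by simp⟩
      symm := by
        rintro L L' ⟨c, hc⟩
        exact ⟨c⁻¹, by rw [hc, smul_smul]; simp⟩
      trans := by
        rintro L L' L'' ⟨c, hc⟩ ⟨c', hc'⟩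
        exact ⟨c' * c, by rw [hc', hc, smul_smul, Units.val_mul]⟩ }

/-- The vertex set of the affine building of `F ^ d`: similarity classes of lattices. -/
def BuildingVertex : Type _ := Quotient (latticeSetoid O F d)

variable {O F d} in
theorem smul_similar (g : GL (Fin d) F) {L L' : Lattice O F d} (h : L ≈ L') : g • L ≈ g • L' := by
  obtain ⟨c, hc⟩ := h
  refine ⟨c, ?_⟩
  change L'.1.map (glMap O g) = (c : F) • L.1.map (glMap O g)
  rw [hc]
  ext v
  simp only [Submodule.mem_map, Submodule.mem_smul_pointwise_iff_exists]
  constructor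
  · rintro ⟨_, ⟨w, hw, rfl⟩, rfl⟩
    exact ⟨_, ⟨w, hw, rfl⟩, by simp [glMap]⟩
  · rintro ⟨_, ⟨w, hw, rfl⟩, rfl⟩
    exact ⟨_, ⟨w, hw, rfl⟩, by simp [glMap]⟩

/-- The induced action of `GL(d, F)` on the vertices: `g ⟨L⟩ = ⟨g L⟩`. -/
instance : MulAction (GL (Fin d) F) (BuildingVertex O F d) where
  smul g := Quotient.map (g • ·) (fun _ _ h => smul_similar g h)
  one_smul := by
    rintro ⟨L⟩
    exact congrArg (Quotient.mk _) (one_smul _ L)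
  mul_smul g h := by
    rintro ⟨L⟩
    exact congrArg (Quotient.mk _) (mul_smul g h L)

variable {O F d} in
/-- Scalar matrices act trivially on the vertices. -/
theorem scalar_smul (c : F) (g : GL (Fin d) F)
    (h : (g : Matrix (Fin d) (Fin d) F) = algebraMap F _ c) (hc : c ≠ 0)
    (x : BuildingVertex O F d) : g • x = x := by
  obtain ⟨L⟩ := x
  refine Quotient.sound (Setoid.symm ?_)
  refine ⟨Units.mk0 c hc, ?_⟩
  change L.1.map (glMap O g) = c • L.1
  have hv : ∀ v, glMap O g v = c • v := fun v => by
    change (g : Matrix (Fin d) (Fin d) F).mulVec v = c • v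
    rw [h, Algebra.algebraMap_eq_smul_one, Matrix.smul_mulVec, Matrix.one_mulVec]
  ext v
  simp only [Submodule.mem_map, Submodule.mem_smul_pointwise_iff_exists, hv]

end Lattices

/-! ## The action on the building at `p` -/

section LocalAction

variable (k K : Type*) [Field k] [Fintype k] [Field K] [Algebra k K] [FiniteDimensional k K]
  (d : ℕ) {p : k[X]} (hp : Irreducible p)

variable {k} in
/-- The place of `k(t)` defined by the irreducible polynomial `p`. -/
def place : IsDedekindDomain.HeightOneSpectrum k[X] where
  asIdeal := Ideal.span {p}
  isPrime := (Ideal.span_singleton_prime hp.ne_zero).2 hp.prime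
  ne_bot := by simpa using hp.ne_zero

variable {k} in
/-- `k(t)_p`, the completion of `k(t)` at `p`. -/
abbrev LocalField : Type _ := (place hp).adicCompletion (RatFunc k)

variable {k} in
/-- `k[t]_p`, the valuation ring of `k(t)_p`. -/
abbrev LocalRing : Type _ := (place hp).adicCompletionIntegers (RatFunc k)

/-- The canonical homomorphism `k[t]_p ⊗ K{τ} → k(t)_p ⊗ K{τ}`. -/
def localOrderMap : Order k K (LocalRing hp) →ₐ[k[X]] Order k K (LocalField hp) :=
  Algebra.TensorProduct.map (IsScalarTower.toAlgHom k[X] (LocalRing hp) (LocalField hp))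
    (AlgHom.id k[X] (SkewPoly k K))

/-- An isomorphism of `k(t)_p`-algebras `k(t)_p ⊗ K{τ} ≅ M(d, k(t)_p)` inducing an isomorphism
of the local orders `k[t]_p ⊗ K{τ}` and `M(d, k[t]_p)`. -/
structure LocalSplitting where
  /-- The isomorphism over `k(t)_p`. -/
  toAlgEquiv : Order k K (LocalField hp) ≃ₐ[LocalField hp] Matrix (Fin d) (Fin d) (LocalField hp)
  /-- It carries the image of `k[t]_p ⊗ K{τ}` onto `M(d, k[t]_p)`. -/
  map_order : ∀ x, x ∈ (localOrderMap k K hp).range ↔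
    ∀ i j, toAlgEquiv x i j ∈ (place hp).adicCompletionIntegers (RatFunc k)

theorem isUnit_localField : IsUnit (Algebra.ofId k[X] (LocalField hp) p) := by
  rw [isUnit_iff_ne_zero]
  change algebraMap k[X] (LocalField hp) p ≠ 0
  rw [IsScalarTower.algebraMap_apply k[X] (RatFunc k) (LocalField hp)]
  simpa using hp.ne_zero

/-- The embedding `k[t][1/p] → k(t)_p`. -/
def awayToLocal : Localization.Away p →ₐ[k[X]] LocalField hp :=
  IsLocalization.liftAlgHom (M := Submonoid.powers p) (f := Algebra.ofId k[X] (LocalField hp)) (by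
    rintro ⟨_, n, rfl⟩
    simpa using (isUnit_localField k hp).pow n)

/-- The canonical homomorphism `K{τ}[1/p] → k(t)_p ⊗ K{τ}`. -/
def orderAwayToLocal : OrderAway k K p →ₐ[k[X]] Order k K (LocalField hp) :=
  Algebra.TensorProduct.map (awayToLocal k hp) (AlgHom.id k[X] (SkewPoly k K))

variable {k K d hp}

/-- The embedding `K{τ}[1/p]ˣ → GL(d, k(t)_p)` given by the chosen isomorphism. -/
def LocalSplitting.toGL (φ : LocalSplitting k K d hp) :
    (OrderAway k K p)ˣ →* GL (Fin d) (LocalField hp) :=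
  (Units.map φ.toAlgEquiv.toAlgHom.toRingHom.toMonoidHom).comp
    (Units.map (orderAwayToLocal k K hp).toRingHom.toMonoidHom)

/-- The action of `Γ(1)` on the vertices of the building of `k(t)_p ^ d`, induced by
`K{τ}[1/p]ˣ → GL(d, k(t)_p)`. -/
def LocalSplitting.vertexAction (φ : LocalSplitting k K d hp) :
    GammaOne k K p →* Equiv.Perm (BuildingVertex (LocalRing hp) (LocalField hp) d) :=
  QuotientGroup.lift (scalarUnits k K p) ((MulAction.toPermHom _ _).comp φ.toGL) (by
    rintro _ ⟨z, rfl⟩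
    ext x
    refine scalar_smul (awayToLocal k hp z) _ ?_ (z.isUnit.map (awayToLocal k hp)).ne_zero x
    change φ.toAlgEquiv (orderAwayToLocal k K hp ((z : Localization.Away p) ⊗ₜ 1)) = _
    rw [orderAwayToLocal, Algebra.TensorProduct.map_tmul, map_one]
    exact φ.toAlgEquiv.commutes _)

theorem LocalSplitting.vertexAction_mk (φ : LocalSplitting k K d hp) (g : (OrderAway k K p)ˣ)
    (x : BuildingVertex (LocalRing hp) (LocalField hp) d) :
    φ.vertexAction (QuotientGroup.mk g) x = φ.toGL g • x := rfl

end LocalAction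

end SkewBuilding

end

noncomputable section

namespace SkewBuilding

/-! ### Arithmetic of `K{τ}`: degrees, units, right ideals, freeness over `k[t]`. -/

section SkewPolynomials

variable (k K : Type*) [Field k] [Fintype k] [Field K] [Algebra k K]

variable {k K}

/-! Write `O = k[t]_p`, `F = k(t)_p`, and let `σ` be the Frobenius of `K/k` extended to `O ⊗ K`.

Splitting. `O` is Henselian with finite residue field and `t` is a unit in it, so `t = N(u)` for
some `u ∈ O ⊗ K` (`exists_norm_eq`). Letting `K` act on `O ⊗ K` by multiplication and `τ` by `s ↦ u
σ(s)` gives a `k[t]`-linear action of `K{τ}`, because `(u σ)^d = N(u) = t`. By the trace form its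
image spans all endomorphisms (`exists_hom_matrix`), and counting `d²` generators makes the induced
map bijective over both `O` and `F` (`orderLift_bijective`).

Transitivity. A vertex is the class of `G O^d` with `G` integral. The elements of `K{τ}` whose image
lies in `G M(d, O)` form a right ideal, which is principal, `f K{τ}`, by the division algorithm
(`exists_generator`). It contains a power of `p`, so `f` is invertible in `K{τ}[1/p]`; since `K{τ}`
is dense in the local order, `f` and `G` differ by an element of `GL(d, O)`. A constant factor makes
`f(0) = 1`, which puts `f` in `Γ(τ)` without changing the vertex.

Freeness. An element fixing `O^d` up to similarity can be multiplied by a power of `p` so as to lie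
in `GL(d, O)`. It and its inverse are then in `K{τ}` (`LocalSplitting.exists_eq_one_tmul`), whose
units are constants. A constant with class in `Γ(τ)` lies in `kˣ`, hence is trivial in `Γ(1)`. -/

theorem coeff_const_mul_tau_pow (a : FrobField k K) (n l : ℕ) :
    (const k K a * tau k K ^ n).coeff l = if n = l then a else 0 := by
  have : const k K a * tau k K ^ n = SkewPolynomial.monomial n a := by
    rw [← SkewPolynomial.C_mul_X_pow_eq_monomial]
    rfl
  rw [this, SkewPolynomial.coeff_monomial]

theorem coeff_const (a : FrobField k K) (l : ℕ) :
    (const k K a).coeff l = if 0 = l then a else 0 := by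
  simpa using coeff_const_mul_tau_pow a 0 l

theorem const_mul_tau_pow_mul (a b : FrobField k K) (n m : ℕ) :
    const k K a * tau k K ^ n * (const k K b * tau k K ^ m)
      = const k K (a * b ^ Fintype.card k ^ n) * tau k K ^ (n + m) := by
  rw [mul_assoc, ← mul_assoc (tau k K ^ n), tau_pow_mul_const, map_mul, pow_add, mul_assoc,
    mul_assoc]

theorem coeff_mul (f g : SkewPoly k K) (l : ℕ) :
    (f * g).coeff l = ∑ x ∈ Finset.HasAntidiagonal.antidiagonal l,
      f.coeff x.1 * g.coeff x.2 ^ Fintype.card k ^ x.1 := by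
  have hadd : ∀ (n : ℕ) (a b : FrobField k K), (a + b) ^ Fintype.card k ^ n
      = a ^ Fintype.card k ^ n + b ^ Fintype.card k ^ n := by
    intro n a b
    have := map_add ((FiniteField.frobeniusAlgHom k (FrobField k K)) ^ n) a b
    simpa only [AlgHom.coe_pow, FiniteField.coe_frobeniusAlgHom, pow_iterate] using this
  have h0 : ∀ n : ℕ, (0 : FrobField k K) ^ Fintype.card k ^ n = 0 := fun n =>
    zero_pow (pow_ne_zero _ Fintype.card_ne_zero)
  induction f using skewPoly_induction k K with
  | add f₁ f₂ h₁ h₂ =>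
    simp only [add_mul, SkewPolynomial.coeff_add, h₁, h₂, Finset.sum_add_distrib]
  | mono a n =>
    induction g using skewPoly_induction k K with
    | add g₁ g₂ h₁ h₂ =>
      simp only [mul_add, SkewPolynomial.coeff_add, h₁, h₂, hadd, Finset.sum_add_distrib]
    | mono b m =>
      rw [const_mul_tau_pow_mul]
      simp only [coeff_const_mul_tau_pow]
      by_cases h : n + m = l
      · rw [if_pos h, Finset.sum_eq_single (n, m)]
        · simp
        · rintro ⟨i, j⟩ - hij
          by_cases hi : n = i
          · have hj : m ≠ j := fun hj => hij (by rw [hi, hj])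
            simp [hj, h0]
          · simp [hi]
        · intro h'
          exact absurd (Finset.HasAntidiagonal.mem_antidiagonal.2 h) h'
      · rw [if_neg h, Finset.sum_eq_zero]
        rintro ⟨i, j⟩ hij
        rw [Finset.HasAntidiagonal.mem_antidiagonal] at hij
        by_cases hi : n = i
        · have hj : m ≠ j := by rintro rfl; exact h (hi ▸ hij)
          simp [hj, h0]
        · simp [hi]

/-- The coefficients of `f` above `n` vanish. -/
def DegreeLE (f : SkewPoly k K) (n : ℕ) : Prop := ∀ i, n < i → f.coeff i = 0

theorem DegreeLE.coeff_mul {f g : SkewPoly k K} {n m : ℕ} (hf : DegreeLE f n) (hg : DegreeLE g m) :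
    (f * g).coeff (n + m) = f.coeff n * g.coeff m ^ Fintype.card k ^ n := by
  rw [SkewBuilding.coeff_mul, Finset.sum_eq_single (n, m)]
  · rintro ⟨i, j⟩ hij hne
    rw [Finset.HasAntidiagonal.mem_antidiagonal] at hij
    rcases lt_trichotomy n i with h | h | h
    · simp [hf i h]
    · exact absurd (by ext <;> simp_all) hne
    · simp [hg j (by simp only at hij; omega)]
  · intro h'
    exact absurd (Finset.HasAntidiagonal.mem_antidiagonal.2 (rfl : (n, m).1 + (n, m).2 = _)) h'

omit [Field k] [Fintype k] [Algebra k K] in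
theorem exists_degree {f : SkewPoly k K} (hf : f ≠ 0) :
    ∃ n, DegreeLE f n ∧ f.coeff n ≠ 0 := by
  have hs : f.support.Nonempty := by
    rw [Finset.nonempty_iff_ne_empty]
    simpa using hf
  refine ⟨f.support.max' hs, fun i hi => ?_, ?_⟩
  · by_contra h
    exact absurd (f.support.le_max' i (SkewPolynomial.mem_support_iff.2 h)) (by omega)
  · exact SkewPolynomial.mem_support_iff.1 (Finset.max'_mem _ _)

theorem coeff_add_mul_ne_zero {f g : SkewPoly k K} {n m : ℕ} (hf : DegreeLE f n)
    (hfn : f.coeff n ≠ 0) (hg : DegreeLE g m) (hgm : g.coeff m ≠ 0) :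
    (f * g).coeff (n + m) ≠ 0 := by
  rw [hf.coeff_mul hg]
  exact mul_ne_zero hfn (pow_ne_zero _ hgm)

instance : NoZeroDivisors (SkewPoly k K) where
  eq_zero_or_eq_zero_of_mul_eq_zero {f g} h := by
    by_contra! hne
    obtain ⟨n, hf, hfn⟩ := exists_degree hne.1
    obtain ⟨m, hg, hgm⟩ := exists_degree hne.2
    exact coeff_add_mul_ne_zero hf hfn hg hgm (by rw [h, SkewPolynomial.coeff_zero])

instance : IsDomain (SkewPoly k K) := NoZeroDivisors.to_isDomain _

/-- Degrees add, so both factors have degree 0. This is what makes the stabilizer of a vertex small.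
-/
theorem exists_const_of_mul_eq_one {f g : SkewPoly k K} (h : f * g = 1) :
    ∃ a, f = const k K a := by
  have hf0 : f ≠ 0 := by rintro rfl; simp at h
  have hg0 : g ≠ 0 := by rintro rfl; simp at h
  obtain ⟨n, hf, hfn⟩ := exists_degree hf0
  obtain ⟨m, hg, hgm⟩ := exists_degree hg0
  have hc := coeff_add_mul_ne_zero hf hfn hg hgm
  rw [h, SkewPolynomial.coeff_one] at hc
  have hn : n = 0 := by
    by_contra hn
    exact hc (if_neg (by omega))
  subst hn
  refine ⟨f.coeff 0, SkewPolynomial.ext fun i => ?_⟩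
  rw [coeff_const]
  split_ifs with hi
  · rw [hi]
  · exact hf i (by omega)

/-- Every right ideal of `K{τ}` is principal. -/
theorem exists_generator [FiniteDimensional k K] (I : AddSubgroup (SkewPoly k K))
    (hI : ∀ f ∈ I, ∀ g, f * g ∈ I) : ∃ f ∈ I, ∀ h ∈ I, ∃ g, h = f * g := by
  classical
  by_cases hbot : ∀ f ∈ I, f = 0
  · exact ⟨0, I.zero_mem, fun h hh => ⟨0, by simp [hbot h hh]⟩⟩
  push Not at hbot
  obtain ⟨f₀, hf₀, hf₀0⟩ := hbot
  have hex : ∃ n, ∃ f ∈ I, DegreeLE f n ∧ f.coeff n ≠ 0 := by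
    obtain ⟨n, hn⟩ := exists_degree hf₀0
    exact ⟨n, f₀, hf₀, hn⟩
  obtain ⟨f, hfI, hf, hfn⟩ := Nat.find_spec hex
  have hmin := fun m hm => Nat.find_min hex (m := m) hm
  generalize Nat.find hex = n at hf hfn hmin
  refine ⟨f, hfI, ?_⟩
  -- The leading coefficient of `f * (c τ^j)` is that of `f` times `c ^ q ^ n`. Division with `f` on
  -- the left thus needs `q ^ n`-th roots, which exist because `K` is finite.
  have hroot : ∀ b : FrobField k K, ∃ c, c ^ Fintype.card k ^ n = b := by
    intro b
    have := Module.finite_of_finite k (M := FrobField k K)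
    have hinj : Function.Injective (((FiniteField.frobeniusAlgHom k (FrobField k K)) ^ n :
      FrobField k K →ₐ[k] FrobField k K)) := RingHom.injective _
    obtain ⟨c, hc⟩ := (Finite.surjective_of_injective hinj) b
    exact ⟨c, by simpa only [AlgHom.coe_pow, FiniteField.coe_frobeniusAlgHom, pow_iterate] using hc⟩
  -- Here `m` is a strict bound on the degree of `h`, so that the base case is `h = 0`.
  have key : ∀ m, ∀ h ∈ I, (∀ i, m ≤ i → h.coeff i = 0) → ∃ g, h = f * g := by
    intro m
    induction m with
    | zero =>
      intro h _ hm
      exact ⟨0, by rw [mul_zero]; exact SkewPolynomial.ext fun i => hm i (Nat.zero_le _)⟩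
    | succ m ih =>
      intro h hh hm
      by_cases hmn : m < n
      · refine ih h hh fun i hi => ?_
        rcases hi.eq_or_lt with rfl | hi
        · by_contra hc
          exact hmin m hmn ⟨h, hh, fun i hi => hm i hi, hc⟩
        · exact hm i hi
      · push Not at hmn
        obtain ⟨c, hc⟩ := hroot (h.coeff m / f.coeff n)
        set g := const k K c * tau k K ^ (m - n) with hg
        have hgd : DegreeLE g (m - n) := fun i hi => by
          rw [hg, coeff_const_mul_tau_pow, if_neg (by omega)]
        have hgc : g.coeff (m - n) = c := by
          rw [hg, coeff_const_mul_tau_pow, if_pos rfl]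
        have htop := hf.coeff_mul hgd
        rw [hgc, hc, mul_div_cancel₀ _ hfn, show n + (m - n) = m by omega] at htop
        obtain ⟨g', hg'⟩ := ih (h - f * g) (I.sub_mem hh (hI f hfI g)) (fun i hi => by
          rw [SkewPolynomial.coeff_sub]
          rcases hi.eq_or_lt with rfl | hi
          · rw [htop, sub_self]
          · rw [hm i hi, SkewBuilding.coeff_mul, Finset.sum_eq_zero, sub_self]
            rintro ⟨a, b⟩ hab
            rw [Finset.HasAntidiagonal.mem_antidiagonal] at hab
            rcases lt_or_ge n a with h' | h'
            · simp [hf a h']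
            · simp [hgd b (by simp only at hab; omega)])
        exact ⟨g + g', by rw [mul_add, ← hg']; abel⟩
  intro h hh
  by_cases h0 : h = 0
  · exact ⟨0, by simp [h0]⟩
  obtain ⟨m, hm, -⟩ := exists_degree h0
  exact key (m + 1) h hh fun i hi => hm i hi

variable [FiniteDimensional k K]

theorem algebraMap_C (c : k) :
    algebraMap k[X] (SkewPoly k K) (C c) = const k K (algebraMap k _ c) := by
  change centerHom k K (C c) = _
  simp [centerHom]

/-- Since `τ ^ d = t`, an exponent matters only modulo `d`. For a finite basis this is a family of
exactly `d²` generators, the rank of the matrix algebra. -/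
theorem span_const_mul_tau_pow {ι : Type*} (b : Module.Basis ι k (FrobField k K)) :
    Submodule.span k[X] (Set.range fun x : ι × Fin (Module.finrank k K) =>
      const k K (b x.1) * tau k K ^ (x.2 : ℕ)) = ⊤ := by
  rw [eq_top_iff]
  rintro f -
  induction f using skewPoly_induction k K with
  | add f g hf hg => exact add_mem hf hg
  | mono a n =>
    induction b.mem_span a using Submodule.span_induction with
    | zero => simp
    | add x y _ _ hx hy => rw [map_add, add_mul]; exact add_mem hx hy
    | smul c x _ hx =>
      have : const k K (c • x) * tau k K ^ n
          = (C c : k[X]) • (const k K x * tau k K ^ n) := by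
        rw [Algebra.smul_def, Algebra.smul_def, algebraMap_C, map_mul, mul_assoc]
      rw [this]
      exact Submodule.smul_mem _ _ hx
    | mem x hx =>
      obtain ⟨i, rfl⟩ := hx
      have hd : 0 < Module.finrank k K := Module.finrank_pos
      have : const k K (b i) * tau k K ^ n = (X ^ (n / Module.finrank k K) : k[X]) •
          (const k K (b i) * tau k K ^ (n % Module.finrank k K)) := by
        rw [Algebra.smul_def, Algebra.commutes, map_pow, algebraMap_X, ← pow_mul, mul_assoc,
          ← pow_add, Nat.mod_add_div]
      rw [this]
      exact Submodule.smul_mem _ _ (Submodule.subset_span ⟨(i, ⟨_, Nat.mod_lt _ hd⟩), rfl⟩)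

instance : Module.Finite k[X] (SkewPoly k K) := by
  have b := Module.finBasis k (FrobField k K)
  refine ⟨⟨(Set.range fun x : _ × Fin (Module.finrank k K) =>
      const k K (b x.1) * tau k K ^ (x.2 : ℕ)).toFinite.toFinset, ?_⟩⟩
  rw [Set.Finite.coe_toFinset]
  exact span_const_mul_tau_pow b

theorem algebraMap_skewPoly_injective :
    Function.Injective (algebraMap k[X] (SkewPoly k K)) := by
  have hd : Module.finrank k K ≠ 0 := Module.finrank_pos.ne'
  have key : ∀ f : k[X], ∀ n, (algebraMap k[X] (SkewPoly k K) f).coeff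
      (n * Module.finrank k K) = algebraMap k (FrobField k K) (f.coeff n) := by
    intro f n
    change (centerHom k K f).coeff _ = _
    induction f using Polynomial.induction_on' with
    | add f g hf hg => simp [hf, hg]
    | monomial m c =>
      rw [centerHom_monomial, ← pow_mul, coeff_const_mul_tau_pow, coeff_monomial]
      by_cases h : m = n
      · simp [h, mul_comm]
      · rw [if_neg h, if_neg, map_zero]
        intro h'
        rw [mul_comm] at h'
        exact h (Nat.eq_of_mul_eq_mul_right (Nat.pos_of_ne_zero hd) h')
  intro f g h
  ext n
  apply (algebraMap k (FrobField k K)).injective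
  rw [← key, ← key, h]

instance : Module.IsTorsionFree k[X] (SkewPoly k K) := .of_smul_eq_zero fun f x h => by
  rw [Algebra.smul_def, mul_eq_zero] at h
  exact h.imp_left fun h => algebraMap_skewPoly_injective (by rw [h, map_zero])

/-- Coordinates over `k[t]` will reduce divisibility by `p ^ n` in `K{τ}` to divisibility of
polynomials. -/
instance : Module.Free k[X] (SkewPoly k K) := Module.free_of_finite_type_torsion_free'

omit [FiniteDimensional k K] in
/-- The universal property of `K{τ}`. -/
theorem exists_skewPoly_hom {E : Type*} [Ring E] (ρ : FrobField k K →+* E) (T : E)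
    (h : ∀ a, T * ρ a = ρ (a ^ Fintype.card k) * T) :
    ∃ r : SkewPoly k K →+* E, (∀ a, r (const k K a) = ρ a) ∧ r (tau k K) = T := by
  have hn : ∀ (n : ℕ) a, T ^ n * ρ a = ρ (a ^ Fintype.card k ^ n) * T ^ n := by
    intro n
    induction n with
    | zero => simp
    | succ n ih =>
      intro a
      rw [pow_succ, mul_assoc, h, ← mul_assoc, ih, mul_assoc, ← pow_mul, pow_succ']
  let r : SkewPoly k K →+* E := SkewMonoidAlgebra.liftNCRingHom ρ (powersHom E T) (by
    intro x y
    have hy : y • x = x ^ Fintype.card k ^ y.toAdd := by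
      have := SkewPolynomial.φ_iterate_apply (R := FrobField k K) y.toAdd x
      rw [ofAdd_toAdd] at this
      rw [← this]
      induction y.toAdd with
      | zero => simp
      | succ n ih => rw [Function.iterate_succ_apply', ih, phi_apply, ← pow_mul, pow_succ]
    rw [hy, powersHom_apply, hn])
  refine ⟨r, fun a => ?_, ?_⟩
  · exact (SkewMonoidAlgebra.liftNC_single _ _ _ _).trans (by simp)
  · exact (SkewMonoidAlgebra.liftNC_single _ _ _ _).trans (by simp)

end SkewPolynomials

/-! ### Norms and Frobenius conjugates on `B ⊗ L`. -/

section Norm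

variable {k L : Type*} [Field k] [Fintype k] [Field L] [Algebra k L]
variable (L) (B : Type*) [CommRing B] [Algebra k B]

/-- The Frobenius of `L` over `k`, extended linearly to `B ⊗ L`. -/
def frob : B ⊗[k] L →ₐ[B] B ⊗[k] L :=
  Algebra.TensorProduct.map (AlgHom.id B B) (FiniteField.frobeniusAlgHom k L)

variable {L B}

theorem frob_pow_tmul (n : ℕ) (o : B) (x : L) :
    ((frob L B : B ⊗[k] L →ₐ[B] B ⊗[k] L) ^ n) (o ⊗ₜ x) = o ⊗ₜ (x ^ Fintype.card k ^ n) := by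
  induction n with
  | zero => simp
  | succ n ih =>
    rw [pow_succ', AlgHom.mul_apply, ih, frob, Algebra.TensorProduct.map_tmul,
      FiniteField.coe_frobeniusAlgHom]
    simp [← pow_mul, pow_succ]

theorem map_frob_pow {B' : Type*} [CommRing B'] [Algebra k B'] (π : B →ₐ[k] B') (n : ℕ)
    (s : B ⊗[k] L) : Algebra.TensorProduct.map π (AlgHom.id k L) ((frob L B ^ n) s)
      = (frob L B' ^ n) (Algebra.TensorProduct.map π (AlgHom.id k L) s) := by
  induction s with
  | zero => simp
  | add s s' h h' => simp only [map_add, h, h']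
  | tmul o x => simp only [frob_pow_tmul, Algebra.TensorProduct.map_tmul, AlgHom.id_apply]

variable [FiniteDimensional k L]

theorem sum_pow_eq_trace (x : L) :
    ∑ l : Fin (Module.finrank k L), x ^ Fintype.card k ^ (l : ℕ)
      = algebraMap k L (Algebra.trace k L x) := by
  have := Module.finite_of_finite k (M := L)
  rw [FiniteField.algebraMap_trace_eq_sum_pow, Nat.card_eq_fintype_card, Finset.sum_range]

theorem frob_pow_finrank : (frob L B : B ⊗[k] L →ₐ[B] B ⊗[k] L) ^ Module.finrank k L = 1 := by
  ext x
  simp only [AlgHom.coe_comp, AlgHom.coe_restrictScalars', Function.comp_apply,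
    Algebra.TensorProduct.includeRight_apply, frob_pow_tmul, AlgHom.one_apply]
  have := Module.finite_of_finite k (M := L)
  have := congrArg (fun f => f x) (pow_orderOf_eq_one (FiniteField.frobeniusAlgHom k L))
  rw [FiniteField.orderOf_frobeniusAlgHom] at this
  simp only [AlgHom.coe_pow, FiniteField.coe_frobeniusAlgHom, pow_iterate, AlgHom.one_apply] at this
  rw [this]

/-- The norm of `B ⊗ L` over `B` is the product of the conjugates. -/
theorem algebraMap_norm_eq_prod_frob (s : B ⊗[k] L) :
    algebraMap B (B ⊗[k] L) (Algebra.norm B s)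
      = ∏ l : Fin (Module.finrank k L), (frob L B ^ (l : ℕ)) s := by
  let b := Module.finBasis k L
  let bb := Algebra.TensorProduct.basis B b
  -- `P` is the matrix of conjugates of a basis and `Q` that of the trace-dual basis, so `Q * P` has
  -- traces `Tr(bᵢ* bⱼ)` as entries. `P` conjugates multiplication by `s` into the diagonal matrix
  -- of the conjugates of `s`.
  let P : Matrix (Fin (Module.finrank k L)) (Fin (Module.finrank k L)) (B ⊗[k] L) :=
    Matrix.of fun l j => (frob L B ^ (l : ℕ)) (bb j)
  let Q : Matrix (Fin (Module.finrank k L)) (Fin (Module.finrank k L)) (B ⊗[k] L) :=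
    Matrix.of fun j l => (frob L B ^ (l : ℕ)) (1 ⊗ₜ b.traceDual j)
  have hQP : Q * P = 1 := by
    ext i j
    simp only [Matrix.mul_apply, Q, P, Matrix.of_apply, bb, Algebra.TensorProduct.basis_apply,
      frob_pow_tmul, Algebra.TensorProduct.tmul_mul_tmul, mul_one, ← mul_pow]
    rw [← tmul_sum, sum_pow_eq_trace, Module.Basis.trace_traceDual_mul, Matrix.one_apply]
    by_cases h : i = j
    · simp [h, Algebra.TensorProduct.one_def]
    · simp [h, Ne.symm h]
  have hdet : P.det * Q.det = 1 := by rw [mul_comm, ← Matrix.det_mul, hQP, Matrix.det_one]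
  have hmul : Matrix.diagonal (fun l : Fin (Module.finrank k L) => (frob L B ^ (l : ℕ)) s) * P
      = P * (Algebra.leftMulMatrix bb s).map (algebraMap B (B ⊗[k] L)) := by
    ext l j
    rw [Matrix.diagonal_mul, Matrix.mul_apply]
    simp only [P, Matrix.of_apply, Matrix.map_apply]
    rw [← map_mul]
    conv_lhs => rw [← bb.sum_repr (s * bb j)]
    rw [map_sum]
    refine Finset.sum_congr rfl fun i _ => ?_
    rw [map_smul, Algebra.leftMulMatrix_eq_repr_mul, Algebra.smul_def, mul_comm]
  have := congrArg Matrix.det hmul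
  rw [Matrix.det_mul, Matrix.det_mul, Matrix.det_diagonal, mul_comm P.det] at this
  have h2 := congrArg (· * Q.det) this
  simp only [mul_assoc, hdet, mul_one] at h2
  rw [h2, Algebra.norm_eq_matrix_det bb, RingHom.map_det]
  rfl

/-- Every `B`-linear endomorphism of `B ⊗ L` is a combination of powers of the Frobenius. -/
theorem exists_end_eq_sum_frob (φ : Module.End B (B ⊗[k] L)) :
    ∃ c : Fin (Module.finrank k L) → B ⊗[k] L, ∀ s, φ s = ∑ l, c l * (frob L B ^ (l : ℕ)) s := by
  let b := Module.finBasis k L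
  -- Apply `φ` to `x = ∑ Tr(bᵢ x) bᵢ*` and expand each trace as a sum of conjugates.
  refine ⟨fun l => ∑ i, φ (1 ⊗ₜ b.traceDual i) * (frob L B ^ (l : ℕ)) (1 ⊗ₜ b i), fun s => ?_⟩
  induction s with
  | zero => simp
  | add s s' h h' => simp only [map_add, h, h', mul_add, Finset.sum_add_distrib]
  | tmul o x =>
    have hx : x = ∑ i, Algebra.trace k L (b i * x) • b.traceDual i := by
      conv_lhs => rw [← b.traceDual.sum_repr x]
      simp only [Module.Basis.traceDual_repr_apply, Algebra.traceForm_apply, mul_comm]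
    have ho : o ⊗ₜ[k] x = ∑ i, (Algebra.trace k L (b i * x) • o) • (1 ⊗ₜ[k] b.traceDual i) := by
      conv_lhs => rw [hx]
      rw [tmul_sum]
      refine Finset.sum_congr rfl fun i _ => ?_
      rw [tmul_smul, smul_tmul', smul_tmul', smul_eq_mul, mul_one]
    rw [ho, map_sum]
    simp only [Finset.sum_mul]
    rw [Finset.sum_comm]
    refine Finset.sum_congr rfl fun i _ => ?_
    simp only [mul_assoc, ← map_mul, ← ho, Algebra.TensorProduct.tmul_mul_tmul, one_mul]
    rw [← Finset.mul_sum]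
    simp only [frob_pow_tmul]
    rw [← tmul_sum, sum_pow_eq_trace, map_smul, Algebra.smul_def, mul_comm,
      Algebra.algebraMap_eq_smul_one (Algebra.trace k L _), tmul_smul, smul_tmul']
    rfl

/-- Multiplication by `u` preserves `I` and is the identity there, so its determinant is the one on
`A ⧸ I`. -/
theorem norm_eq_norm_mk {κ A : Type*} [Field κ] [CommRing A] [Algebra κ A] [Module.Finite κ A]
    (I : Ideal A) {u : A} (h : ∀ x ∈ I, u * x = x) :
    Algebra.norm κ u = Algebra.norm κ (Ideal.Quotient.mk I u) := by
  let W : Submodule κ A := I.restrictScalars κ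
  have hW : W ≤ W.comap (Algebra.lmul κ A u) := fun x hx => I.mul_mem_left u hx
  have hid : (Algebra.lmul κ A u).restrict hW = LinearMap.id :=
    LinearMap.ext fun x => Subtype.ext (h _ x.2)
  let E : (A ⧸ W) ≃ₗ[κ] (A ⧸ I) := Submodule.Quotient.restrictScalarsEquiv κ I
  have hq : Algebra.lmul κ (A ⧸ I) (Ideal.Quotient.mk I u)
      = (E : (A ⧸ W) →ₗ[κ] _) ∘ₗ W.mapQ W (Algebra.lmul κ A u) hW ∘ₗ E.symm := by
    refine LinearMap.ext fun x => ?_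
    obtain ⟨x, rfl⟩ := Ideal.Quotient.mk_surjective x
    have hE : ∀ y : A, E (Submodule.Quotient.mk y) = Ideal.Quotient.mk I y := fun y => rfl
    have hE' : E.symm (Ideal.Quotient.mk I x) = Submodule.Quotient.mk x := by
      rw [LinearEquiv.symm_apply_eq, hE]
    rw [LinearMap.comp_apply, LinearMap.comp_apply, LinearEquiv.coe_coe, LinearEquiv.coe_coe, hE',
      Submodule.mapQ_apply, hE, Algebra.coe_lmul_eq_mul, LinearMap.mul_apply',
      Algebra.coe_lmul_eq_mul, LinearMap.mul_apply', map_mul]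
  rw [Algebra.norm_apply, LinearMap.det_eq_det_mul_det W _ hW, hid, LinearMap.det_id, one_mul,
    Algebra.norm_apply, hq, LinearMap.det_conj]

/-- The norm `κ ⊗ L → κ` is surjective for a finite field `κ`. -/
theorem norm_tensor_surjective (κ : Type*) [Field κ] [Finite κ] [Algebra k κ] :
    Function.Surjective (Algebra.norm κ (S := κ ⊗[k] L)) := by
  intro c
  have := Module.finite_of_finite k (M := L)
  let A := κ ⊗[k] L
  have : Algebra.FormallyUnramified k L := Algebra.FormallyUnramified.of_isSeparable k L
  -- `L/k` is separable, so `κ ⊗ L` is reduced Artinian: a finite product of fields, here finite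
  -- ones. Norms of finite fields are surjective, so a single factor suffices.
  have : IsReduced A := Algebra.FormallyUnramified.isReduced_of_field κ A
  have : IsArtinianRing A := .of_finite κ A
  classical
  obtain ⟨m⟩ : Nonempty (MaximalSpectrum A) := inferInstance
  let := Ideal.Quotient.field m.asIdeal
  have : Module.Finite κ (A ⧸ m.asIdeal) :=
    Module.Finite.of_surjective (Ideal.Quotient.mkₐ κ m.asIdeal).toLinearMap
      Ideal.Quotient.mk_surjective
  have : Finite (A ⧸ m.asIdeal) := Module.finite_of_finite κ
  obtain ⟨y, hy⟩ := FiniteField.norm_surjective κ (A ⧸ m.asIdeal) c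
  obtain ⟨z, rfl⟩ := Ideal.Quotient.mk_surjective y
  -- The idempotent of the factor at `m`. Then `1 + e (z - 1)` is `z` in that factor and `1` in all
  -- the others.
  let e := (IsArtinianRing.equivPi A).symm (Pi.single m 1)
  have he : ∀ n : MaximalSpectrum A, Ideal.Quotient.mk n.asIdeal e
      = (Pi.single m 1 : ∀ I : MaximalSpectrum A, A ⧸ I.asIdeal) n := by
    intro n
    have := IsArtinianRing.equivPi_apply A e n
    rw [AlgEquiv.apply_symm_apply] at this
    exact this.symm
  have hem : ∀ x ∈ m.asIdeal, e * x = 0 := by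
    intro x hx
    apply (IsArtinianRing.equivPi A).injective
    ext n
    rw [IsArtinianRing.equivPi_apply, map_zero, Pi.zero_apply]
    change Ideal.Quotient.mk n.asIdeal (e * x) = 0
    rw [map_mul, he]
    by_cases h : n = m
    · subst h
      rw [Ideal.Quotient.eq_zero_iff_mem.2 hx, mul_zero]
    · rw [Pi.single_eq_of_ne h, zero_mul]
  have hu : Ideal.Quotient.mk m.asIdeal (1 + e * (z - 1)) = Ideal.Quotient.mk m.asIdeal z := by
    rw [map_add, map_one, map_mul, he, Pi.single_eq_same, one_mul, map_sub, map_one]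
    ring
  refine ⟨1 + e * (z - 1), ?_⟩
  rw [norm_eq_norm_mk m.asIdeal, hu, hy]
  intro x hx
  rw [add_mul, one_mul, mul_right_comm, hem _ hx, zero_mul, add_zero]

omit [Fintype k] [FiniteDimensional k L] in
theorem leftMulMatrix_basis {ι : Type*} [Fintype ι] [DecidableEq ι] (b : Module.Basis ι k L)
    (x : L) : Algebra.leftMulMatrix (Algebra.TensorProduct.basis B b) (1 ⊗ₜ x)
      = (Algebra.leftMulMatrix b x).map (algebraMap k B) := by
  ext i j
  rw [Algebra.leftMulMatrix_eq_repr_mul, Algebra.TensorProduct.basis_apply,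
    Algebra.TensorProduct.tmul_mul_tmul, one_mul, Matrix.map_apply,
    Algebra.leftMulMatrix_eq_repr_mul]
  simp

/-- There is a monic polynomial `N(t - θ)`, `θ ∈ L`, with nonzero value and nonzero derivative
at `0`. -/
theorem exists_charpoly_derivative_ne_zero :
    ∃ θ : L, (Algebra.leftMulMatrix (Module.finBasis k L) θ).charpoly.eval 0 ≠ 0 ∧
      (derivative (Algebra.leftMulMatrix (Module.finBasis k L) θ).charpoly).eval 0 ≠ 0 := by
  obtain ⟨w, hw⟩ := Algebra.trace_surjective k L 1
  have hw0 : w ≠ 0 := by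
    rintro rfl
    simp at hw
  let b := Module.finBasis k L
  let M := Algebra.leftMulMatrix b w
  let N := Algebra.leftMulMatrix b (-w⁻¹)
  have hMN : M * N = -1 := by
    rw [← map_mul, mul_neg, mul_inv_cancel₀ hw0, map_neg, map_one]
  have hM : IsUnit M.det := by
    rw [← Matrix.isUnit_iff_isUnit_det]
    exact (Ne.isUnit hw0).map (Algebra.leftMulMatrix b)
  -- For `θ = -w⁻¹` one has `M (X - N) = 1 + X M`, whose determinant is `1 + Tr(w) X + ⋯` with
  -- `Tr(w) = 1`.
  have key : C M.det * N.charpoly = (1 + (X : k[X]) • M.map C).det := by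
    rw [Matrix.charpoly, Matrix.charmatrix, RingHom.map_det, ← Matrix.det_mul]
    congr 1
    rw [mul_sub, ← map_mul, hMN, map_neg, map_one, sub_neg_eq_add, add_comm]
    congr 1
    ext i j
    rw [Matrix.scalar_apply, RingHom.mapMatrix_apply, Matrix.mul_diagonal, Matrix.smul_apply,
      smul_eq_mul, mul_comm]
  refine ⟨-w⁻¹, ?_, ?_⟩
  · have := congrArg (eval 0) key
    rw [eval_det_add_X_smul, Matrix.det_one, eval_one, eval_mul, eval_C] at this
    intro h
    simp only [N, b, h, mul_zero] at this
    exact zero_ne_one this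
  · have := congrArg (fun f => eval 0 (derivative f)) key
    simp only [Matrix.derivative_det_one_add_X_smul, derivative_C_mul, eval_mul, eval_C] at this
    rw [← Algebra.trace_eq_matrix_trace, hw] at this
    intro h
    simp only [N, b, h, mul_zero] at this
    exact zero_ne_one this

/-- The norm `O ⊗ L → O` is surjective on units for a Henselian local ring `O` with finite
residue field. -/
theorem exists_norm_eq (O : Type*) [CommRing O] [Algebra k O] [HenselianLocalRing O]
    [Finite (IsLocalRing.ResidueField O)] {t : O} (ht : IsUnit t) :
    ∃ u : O ⊗[k] L, Algebra.norm O u = t := by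
  obtain ⟨θ, hθ, hθ'⟩ := exists_charpoly_derivative_ne_zero (k := k) (L := L)
  let b := Module.finBasis k L
  let κ := IsLocalRing.ResidueField O
  let π : O →ₐ[k] κ := IsScalarTower.toAlgHom k O κ
  set P := (Algebra.leftMulMatrix b θ).charpoly with hP
  -- The residue field only yields `u` with `N(u) ≡ t / P(0)`. The correcting factor will be `x -
  -- θ`, of norm `P(x)`, where `x` must solve `P(x) = t / N(u)`. Modulo the maximal ideal `x = 0` is
  -- a root, simple because `P'(0) ≠ 0`, so Hensel's lemma applies.
  obtain ⟨v, hv⟩ := norm_tensor_surjective (k := k) (L := L) κ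
    (π t / algebraMap k κ (P.eval 0))
  obtain ⟨u, rfl⟩ : ∃ u, Algebra.TensorProduct.map π (AlgHom.id k L) u = v :=
    TensorProduct.map_surjective (g := π.toLinearMap) (g' := LinearMap.id)
      IsLocalRing.residue_surjective Function.surjective_id v
  have hnorm : π (Algebra.norm O u)
      = Algebra.norm κ (Algebra.TensorProduct.map π (AlgHom.id k L) u) := by
    apply (Algebra.TensorProduct.includeLeft_injective (R := k) (S := k) (A := κ) (B := L)
      (algebraMap k L).injective)
    have h1 := algebraMap_norm_eq_prod_frob (Algebra.TensorProduct.map π (AlgHom.id k L) u)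
    have h2 := congrArg (Algebra.TensorProduct.map π (AlgHom.id k L))
      (algebraMap_norm_eq_prod_frob u)
    simp only [map_prod, map_frob_pow] at h2
    rw [← h1] at h2
    simpa using h2
  rw [hv] at hnorm
  set c := Algebra.norm O u with hc
  have hP0 : algebraMap k κ (P.eval 0) ≠ 0 := by simpa using hθ
  have hπt : π t ≠ 0 := (ht.map π).ne_zero
  have hcu : IsUnit c := by
    by_contra h
    have : π c = 0 := by
      change IsLocalRing.residue O c = 0
      rwa [IsLocalRing.residue_eq_zero_iff, IsLocalRing.mem_maximalIdeal]
    rw [hnorm] at this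
    exact div_ne_zero hπt hP0 this
  obtain ⟨c', hcc'⟩ := hcu.exists_right_inv
  have hQ : (P.map (algebraMap k O) - C (t * c')).Monic := by
    refine Monic.sub_of_left ((Matrix.charpoly_monic _).map _) (degree_C_le.trans_lt ?_)
    rw [(Matrix.charpoly_monic _).degree_map, Matrix.charpoly_degree_eq_dim, Fintype.card_fin]
    exact_mod_cast Module.finrank_pos
  obtain ⟨x, hx, -⟩ := HenselianLocalRing.is_henselian (P.map (algebraMap k O) - C (t * c')) hQ 0
    (by
      rw [← IsLocalRing.residue_eq_zero_iff]
      change π _ = 0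
      have h1 : π c * π c' = 1 := by rw [← map_mul, hcc', map_one]
      rw [hnorm, div_mul_eq_mul_div, div_eq_one_iff_eq hP0] at h1
      rw [eval_sub, eval_C, eval_zero_map, map_sub, map_mul, h1, AlgHom.commutes, sub_self])
    (by
      rw [derivative_sub, derivative_C, sub_zero, derivative_map, eval_zero_map]
      exact (Ne.isUnit hθ').map (algebraMap k O))
  refine ⟨u * (x ⊗ₜ 1 - 1 ⊗ₜ θ), ?_⟩
  have hPx : Algebra.norm O ((x ⊗ₜ 1 : O ⊗[k] L) - 1 ⊗ₜ θ) = (P.map (algebraMap k O)).eval x := by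
    rw [Algebra.norm_eq_matrix_det (Algebra.TensorProduct.basis O b), map_sub, leftMulMatrix_basis,
      hP, ← Matrix.charpoly_map, Matrix.eval_charpoly]
    congr 2
    exact AlgHom.commutes (Algebra.leftMulMatrix (Algebra.TensorProduct.basis O b)) x
  rw [map_mul, hPx, ← hc]
  simp only [IsRoot.def, eval_sub, eval_C, sub_eq_zero] at hx
  rw [hx, mul_comm t, ← mul_assoc, hcc', one_mul]

end Norm

/-! ### Splitting `K{τ}` over a Henselian local ring. -/

section Splitting

variable {k K : Type*} [Field k] [Fintype k] [Field K] [Algebra k K] [FiniteDimensional k K]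

/-- The elements of `B ⊗ L` and the Frobenius twisted by a unit `u` span `End (B ⊗ L)`. -/
theorem end_mem_span {L B : Type*} [Field L] [Algebra k L] [FiniteDimensional k L] [CommRing B]
    [Algebra k B] {u : B ⊗[k] L} (hu : IsUnit u) (φ : Module.End B (B ⊗[k] L)) :
    φ ∈ Submodule.span B {f | ∃ (x : L) (n : ℕ), f = Algebra.lmul B (B ⊗[k] L) (1 ⊗ₜ x) *
      (Algebra.lmul B (B ⊗[k] L) u * (frob L B).toLinearMap : Module.End B (B ⊗[k] L)) ^ n} := by
  set T : Module.End B (B ⊗[k] L) := Algebra.lmul B (B ⊗[k] L) u * (frob L B).toLinearMap with hT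
  -- The twist changes the powers of the Frobenius only by unit factors, which the coefficients
  -- absorb.
  have hpow : ∀ n : ℕ, ∃ w, IsUnit w ∧ ∀ s, (T ^ n) s = w * (frob L B ^ n) s := by
    intro n
    induction n with
    | zero => exact ⟨1, isUnit_one, fun s => by simp⟩
    | succ n ih =>
      obtain ⟨w, hw, h⟩ := ih
      refine ⟨u * frob L B w, hu.mul (hw.map _), fun s => ?_⟩
      rw [pow_succ', Module.End.mul_apply, h, hT, Module.End.mul_apply, AlgHom.toLinearMap_apply,
        map_mul, Algebra.coe_lmul_eq_mul, LinearMap.mul_apply', mul_assoc, pow_succ',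
        AlgHom.mul_apply]
  choose w hw hT' using hpow
  obtain ⟨c, hc⟩ := exists_end_eq_sum_frob φ
  have hφ : φ = ∑ l,
      Algebra.lmul B (B ⊗[k] L) (c l * ((hw l).unit⁻¹ : (B ⊗[k] L)ˣ)) * T ^ (l : ℕ) := by
    refine LinearMap.ext fun s => ?_
    rw [hc, LinearMap.sum_apply]
    refine Finset.sum_congr rfl fun l _ => ?_
    rw [Module.End.mul_apply, Algebra.coe_lmul_eq_mul, LinearMap.mul_apply', hT', mul_assoc,
      ← mul_assoc _ (w l), IsUnit.val_inv_mul, one_mul]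
  rw [hφ]
  refine sum_mem fun l _ => ?_
  induction c l * ((hw l).unit⁻¹ : (B ⊗[k] L)ˣ) with
  | zero => simp
  | add s s' h h' => rw [map_add, add_mul]; exact add_mem h h'
  | tmul o x =>
    have : Algebra.lmul B (B ⊗[k] L) (o ⊗ₜ x) * T ^ (l : ℕ)
        = o • (Algebra.lmul B (B ⊗[k] L) (1 ⊗ₜ x) * T ^ (l : ℕ)) := by
      rw [← smul_mul_assoc, ← map_smul, smul_tmul', smul_eq_mul, mul_one]
    rw [this]
    exact Submodule.smul_mem _ _ (Submodule.subset_span ⟨x, l, rfl⟩)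

/-- `(u σ)^n = u σ(u) ⋯ σ^(n-1)(u) σ^n`; at `n = d` the product is the norm and `σ^d = 1`. This is
why an element of norm `t` yields an action of `τ` with `τ ^ d = t`. -/
theorem twisted_frob_pow {L B : Type*} [Field L] [Algebra k L] [FiniteDimensional k L] [CommRing B]
    [Algebra k B] {u : B ⊗[k] L} :
    (Algebra.lmul B (B ⊗[k] L) u * (frob L B).toLinearMap : Module.End B (B ⊗[k] L))
      ^ Module.finrank k L = algebraMap B _ (Algebra.norm B u) := by
  set T : Module.End B (B ⊗[k] L) := Algebra.lmul B (B ⊗[k] L) u * (frob L B).toLinearMap with hT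
  have hpow : ∀ n : ℕ, ∀ s, (T ^ n) s
      = (∏ l : Fin n, (frob L B ^ (l : ℕ)) u) * (frob L B ^ n) s := by
    intro n
    induction n with
    | zero => simp
    | succ n ih =>
      intro s
      rw [pow_succ', Module.End.mul_apply, ih, hT, Module.End.mul_apply, AlgHom.toLinearMap_apply,
        map_mul, Algebra.coe_lmul_eq_mul, LinearMap.mul_apply', Fin.prod_univ_succ, map_prod,
        pow_succ', AlgHom.mul_apply, mul_assoc]
      simp only [Fin.val_zero, pow_zero, AlgHom.one_apply, Fin.val_succ, pow_succ',
        AlgHom.mul_apply]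
  refine LinearMap.ext fun s => ?_
  rw [hpow, frob_pow_finrank, AlgHom.one_apply, ← algebraMap_norm_eq_prod_frob,
    Module.algebraMap_end_apply, Algebra.smul_def]

/-- `K{τ}` splits over a Henselian local ring with finite residue field in which `t` is a unit. -/
theorem exists_hom_matrix (d : ℕ) (hd : Module.finrank k K = d) (O : Type*) [CommRing O]
    [Algebra k[X] O] [HenselianLocalRing O] [Finite (IsLocalRing.ResidueField O)]
    (hX : IsUnit (algebraMap k[X] O X)) :
    ∃ r : SkewPoly k K →ₐ[k[X]] Matrix (Fin d) (Fin d) O,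
      Submodule.span O (Set.range r) = ⊤ := by
  let : Algebra k O := ((algebraMap k[X] O).comp C).toAlgebra
  let L := FrobField k K
  obtain ⟨u, hu⟩ := exists_norm_eq (k := k) (L := L) O hX
  -- `u` is one of the conjugates whose product is its norm `t`, a unit.
  have huu : IsUnit u := by
    have h : IsUnit (algebraMap O (O ⊗[k] L) (Algebra.norm O u)) := (hu ▸ hX).map _
    rw [algebraMap_norm_eq_prod_frob] at h
    have hpos : 0 < Module.finrank k L := Module.finrank_pos
    exact isUnit_of_dvd_unit (by
      simpa using Finset.dvd_prod_of_mem (fun l : Fin (Module.finrank k L) =>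
        (frob L O ^ (l : ℕ)) u) (Finset.mem_univ ⟨0, hpos⟩)) h
  let b : Module.Basis (Fin d) O (O ⊗[k] L) :=
    Algebra.TensorProduct.basis O (Module.finBasisOfFinrankEq k L hd)
  let e := LinearMap.toMatrixAlgEquiv b
  set T : Module.End O (O ⊗[k] L) := Algebra.lmul O (O ⊗[k] L) u * (frob L O).toLinearMap with hT
  let ρ : L →+* Module.End O (O ⊗[k] L) :=
    (Algebra.lmul O (O ⊗[k] L)).toRingHom.comp
      (Algebra.TensorProduct.includeRight : L →ₐ[k] O ⊗[k] L).toRingHom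
  have hρ : ∀ (a : L) (s : O ⊗[k] L), ρ a s = (1 ⊗ₜ a) * s := fun a s => rfl
  have hTs : ∀ s, T s = u * frob L O s := fun s => rfl
  have hcomm : ∀ a, T * ρ a = ρ (a ^ Fintype.card k) * T := by
    intro a
    refine LinearMap.ext fun s => ?_
    have hfa : frob L O (1 ⊗ₜ[k] a) = 1 ⊗ₜ[k] (a ^ Fintype.card k) := by
      simpa using frob_pow_tmul (k := k) (L := L) (B := O) 1 1 a
    change T (ρ a s) = ρ (a ^ Fintype.card k) (T s)
    rw [hρ, hρ, hTs, hTs, map_mul, hfa, mul_left_comm]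
  obtain ⟨r₀, hr₀, hr₀'⟩ := exists_skewPoly_hom ρ T hcomm
  have hTd : T ^ Module.finrank k K = algebraMap O _ (algebraMap k[X] O X) := by
    rw [← hu]
    exact twisted_frob_pow
  let r : SkewPoly k K →ₐ[k[X]] Matrix (Fin d) (Fin d) O :=
    { e.toRingEquiv.toRingHom.comp r₀ with
      commutes' := by
        intro f
        change e (r₀ (centerHom k K f)) = _
        have : r₀ (centerHom k K f) = algebraMap O _ (algebraMap k[X] O f) := by
          induction f using Polynomial.induction_on' with
          | add f g hf hg => simp only [map_add, hf, hg]
          | monomial m c =>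
            rw [centerHom_monomial, map_mul, hr₀, map_pow, map_pow, hr₀', hTd,
              ← C_mul_X_pow_eq_monomial, map_mul, map_mul, map_pow, map_pow]
            congr 1
            refine LinearMap.ext fun s => ?_
            rw [hρ, Module.algebraMap_end_apply, Algebra.smul_def]
            congr 1
            exact (Algebra.TensorProduct.includeRight : L →ₐ[k] O ⊗[k] L).commutes c
        rw [this, AlgEquiv.commutes]
        rfl }
  refine ⟨r, ?_⟩
  rw [eq_top_iff]
  rintro M -
  have hM := end_mem_span huu (e.symm M)
  have hle : Submodule.span O {f | ∃ (x : L) (n : ℕ), f = Algebra.lmul O (O ⊗[k] L) (1 ⊗ₜ x) *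
      T ^ n} ≤ (Submodule.span O (Set.range r)).comap e.toLinearMap := by
    rw [Submodule.span_le]
    rintro _ ⟨x, n, rfl⟩
    refine Submodule.subset_span ⟨const k K x * tau k K ^ n, ?_⟩
    change e (r₀ _) = e _
    rw [map_mul, map_pow, hr₀, hr₀']
    rfl
  have := hle hM
  rwa [Submodule.mem_comap, AlgEquiv.toLinearMap_apply, AlgEquiv.apply_symm_apply] at this

/-- The extension of a homomorphism `K{τ} → M(d, B)` to `B ⊗ K{τ}`. -/
def orderLift {d : ℕ} {B : Type*} [CommRing B] [Algebra k[X] B]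
    (r : SkewPoly k K →ₐ[k[X]] Matrix (Fin d) (Fin d) B) :
    Order k K B →ₐ[B] Matrix (Fin d) (Fin d) B :=
  Algebra.TensorProduct.lift (Algebra.ofId B _) r fun b x =>
    show Commute (Algebra.ofId B (Matrix (Fin d) (Fin d) B) b) (r x) from Algebra.commutes b _

theorem orderLift_tmul {d : ℕ} {B : Type*} [CommRing B] [Algebra k[X] B]
    (r : SkewPoly k K →ₐ[k[X]] Matrix (Fin d) (Fin d) B) (b : B) (x : SkewPoly k K) :
    orderLift r (b ⊗ₜ x) = b • r x := by
  rw [orderLift, Algebra.TensorProduct.lift_tmul, Algebra.ofId_apply, Algebra.smul_def]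

/-- The source has `d²` generators and the target is free of rank `d²`. The composite `B^(d²) → B ⊗
K{τ} → M(d, B) ≅ B^(d²)` is a surjective endomorphism, hence injective. -/
theorem orderLift_bijective {d : ℕ} (hd : Module.finrank k K = d) {B : Type*} [CommRing B]
    [Algebra k[X] B] (r : SkewPoly k K →ₐ[k[X]] Matrix (Fin d) (Fin d) B)
    (hr : Submodule.span B (Set.range r) = ⊤) : Function.Bijective (orderLift r) := by
  have hg : Function.Surjective (orderLift r) := by
    rw [← AlgHom.coe_toLinearMap, ← LinearMap.range_eq_top, eq_top_iff, ← hr, Submodule.span_le]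
    rintro _ ⟨x, rfl⟩
    exact ⟨1 ⊗ₜ x, by rw [AlgHom.toLinearMap_apply, orderLift_tmul, one_smul]⟩
  subst hd
  let b := Module.finBasis k (FrobField k K)
  let n : Fin (Module.finrank k K) × Fin (Module.finrank k K) → SkewPoly k K :=
    fun x => const k K (b x.1) * tau k K ^ (x.2 : ℕ)
  let f := Fintype.linearCombination B fun x => (1 : B) ⊗ₜ[k[X]] n x
  have hf : Function.Surjective f := by
    rw [← LinearMap.range_eq_top, Fintype.range_linearCombination, eq_top_iff]
    rintro x -
    induction x with
    | zero => simp
    | add x y hx hy => exact add_mem hx hy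
    | tmul c x =>
      have hx : x ∈ Submodule.span k[X] (Set.range n) := by
        have := span_const_mul_tau_pow b
        exact this ▸ Submodule.mem_top
      have : c ⊗ₜ[k[X]] x = c • ((1 : B) ⊗ₜ[k[X]] x) := by
        rw [smul_tmul', smul_eq_mul, mul_one]
      rw [this]
      refine Submodule.smul_mem _ _ ?_
      clear this
      induction hx using Submodule.span_induction with
      | zero => simp
      | add x y _ _ hx hy => rw [tmul_add]; exact add_mem hx hy
      | smul a x _ hx =>
        rw [tmul_smul, ← algebraMap_smul B a]
        exact Submodule.smul_mem _ _ hx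
      | mem x hx =>
        obtain ⟨i, rfl⟩ := hx
        exact Submodule.subset_span ⟨i, rfl⟩
  let E : Matrix (Fin (Module.finrank k K)) (Fin (Module.finrank k K)) B ≃ₗ[B]
      (Fin (Module.finrank k K) × Fin (Module.finrank k K) → B) :=
    (LinearEquiv.curry B B _ _).symm
  have hinj : Function.Injective (E.toLinearMap ∘ₗ (orderLift r).toLinearMap ∘ₗ f) :=
    OrzechProperty.injective_of_surjective_endomorphism _ (E.surjective.comp (hg.comp hf))
  refine ⟨?_, hg⟩
  intro x y hxy
  obtain ⟨x, rfl⟩ := hf x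
  obtain ⟨y, rfl⟩ := hf y
  exact congrArg f (hinj (congrArg E hxy))

/-- The matrix units already lie in the span over `O`. Thus one homomorphism splits both the local
order and the algebra over the field. -/
theorem span_range_mapMatrix {d : ℕ} {O B : Type*} [CommRing O] [CommRing B] [Algebra k[X] O]
    [Algebra k[X] B] [Algebra O B] [IsScalarTower k[X] O B]
    (r : SkewPoly k K →ₐ[k[X]] Matrix (Fin d) (Fin d) O)
    (hr : Submodule.span O (Set.range r) = ⊤) :
    Submodule.span B (Set.range ((IsScalarTower.toAlgHom k[X] O B).mapMatrix.comp r)) = ⊤ := by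
  have h1 : ∀ M : Matrix (Fin d) (Fin d) O, M.map (algebraMap O B) ∈
      Submodule.span B (Set.range ((IsScalarTower.toAlgHom k[X] O B).mapMatrix.comp r)) := by
    intro M
    have hM : M ∈ Submodule.span O (Set.range r) := hr ▸ Submodule.mem_top
    induction hM using Submodule.span_induction with
    | zero => simp
    | add x y _ _ hx hy => rw [Matrix.map_add _ (map_add _)]; exact add_mem hx hy
    | smul a x _ hx =>
      rw [Matrix.map_smul' _ a x (map_mul _)]
      exact Submodule.smul_mem _ _ hx
    | mem x hx =>
      obtain ⟨i, rfl⟩ := hx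
      exact Submodule.subset_span ⟨i, rfl⟩
  rw [eq_top_iff]
  rintro M -
  rw [Matrix.matrix_eq_sum_single M]
  refine sum_mem fun i _ => sum_mem fun j _ => ?_
  have := Submodule.smul_mem _ (M i j) (h1 (Matrix.single i j 1))
  rwa [Matrix.map_single, map_one, Matrix.smul_single, smul_eq_mul, mul_one] at this

end Splitting

/-! ### The completion at `p`: approximation, completeness, residue field. -/

section Local

open WithZero IsDedekindDomain IsDedekindDomain.HeightOneSpectrum Filter Topology

variable {k : Type*} [Field k] {p : k[X]} (hp : Irreducible p)

/-- The image of `p` in `k(t)_p`. -/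
def unif : LocalField hp := algebraMap k[X] (LocalField hp) p

theorem valued_algebraMap (f : k[X]) :
    Valued.v (algebraMap k[X] (LocalField hp) f) = (place hp).intValuation f := by
  rw [← valuation_of_algebraMap (K := RatFunc k)]
  exact valuedAdicCompletion_eq_valuation (K := RatFunc k) (place hp) f

theorem valued_unif : Valued.v (unif hp) = exp (-1 : ℤ) := by
  rw [unif, valued_algebraMap]
  exact intValuation_singleton _ hp.ne_zero rfl

theorem valued_unif_pow (n : ℕ) : Valued.v (unif hp ^ n) = exp (-n : ℤ) := by
  rw [map_pow, valued_unif, ← exp_nsmul]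
  simp

theorem valued_unif_zpow (n : ℤ) : Valued.v (unif hp ^ n) = exp (-n : ℤ) := by
  rw [map_zpow₀, valued_unif, ← exp_zsmul]
  simp

theorem unif_ne_zero : unif hp ≠ 0 := by
  intro h
  have := valued_unif hp
  rw [h, map_zero] at this
  exact exp_ne_zero this.symm

theorem mem_integers_iff {x : LocalField hp} :
    x ∈ (place hp).adicCompletionIntegers (RatFunc k) ↔ Valued.v x ≤ 1 :=
  mem_adicCompletionIntegers _ _ _

theorem algebraMap_mem_integers (f : k[X]) :
    algebraMap k[X] (LocalField hp) f ∈ (place hp).adicCompletionIntegers (RatFunc k) := by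
  rw [mem_integers_iff, valued_algebraMap]
  exact intValuation_le_one _ _

theorem unif_pow_dvd {x : LocalField hp} {n : ℕ} (h : Valued.v x ≤ exp (-n : ℤ)) :
    ∃ y ∈ (place hp).adicCompletionIntegers (RatFunc k), x = unif hp ^ n * y := by
  refine ⟨(unif hp ^ n)⁻¹ * x, ?_, by rw [mul_inv_cancel_left₀ (pow_ne_zero _ (unif_ne_zero hp))]⟩
  rw [mem_integers_iff, map_mul, map_inv₀, valued_unif_pow]
  calc _ ≤ (exp (-n : ℤ))⁻¹ * exp (-n : ℤ) := by gcongr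
    _ = 1 := inv_mul_cancel₀ exp_ne_zero

theorem exists_zpow_mul_valued_eq_one {c : LocalField hp} (hc : c ≠ 0) :
    ∃ n : ℤ, Valued.v (unif hp ^ n * c) = 1 := by
  have h : Valued.v c ≠ 0 := (_root_.map_ne_zero _).2 hc
  refine ⟨log (Valued.v c), ?_⟩
  rw [map_mul, valued_unif_zpow]
  conv_lhs => rw [← exp_log h, log_exp]
  rw [← exp_add, neg_add_cancel, exp_zero]

theorem exists_pow_mul_mem (c : LocalField hp) :
    ∃ n : ℕ, ∀ m, n ≤ m → unif hp ^ m * c ∈ (place hp).adicCompletionIntegers (RatFunc k) := by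
  rcases eq_or_ne c 0 with rfl | hc
  · exact ⟨0, fun m _ => by rw [mul_zero]; exact zero_mem _⟩
  have h : Valued.v c ≠ 0 := (_root_.map_ne_zero _).2 hc
  refine ⟨(log (Valued.v c)).toNat, fun m hm => ?_⟩
  rw [mem_integers_iff, map_mul, valued_unif_pow, ← exp_log h, ← exp_add, ← exp_zero, exp_le_exp]
  omega

/-- Openness serves to approximate by elements of `k(t)`, closedness to keep limits inside a ball.
-/
theorem isClopen_ball_unif (n : ℕ) (x : LocalField hp) :
    IsClopen {y : LocalField hp | (unif hp ^ n)⁻¹ * (y - x) ∈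
      (place hp).adicCompletionIntegers (RatFunc k)} := by
  have hc : Continuous fun y : LocalField hp => (unif hp ^ n)⁻¹ * (y - x) := by fun_prop
  exact (Valued.isClopen_valuationSubring (LocalField hp)).preimage hc

/-- Approximate first by an element of `k(t)`, by density; being integral at `p`, that element is in
turn congruent to a polynomial modulo `p ^ n`. -/
theorem exists_algebraMap_add {x : LocalField hp}
    (hx : x ∈ (place hp).adicCompletionIntegers (RatFunc k)) (n : ℕ) :
    ∃ a : k[X], ∃ y ∈ (place hp).adicCompletionIntegers (RatFunc k),
      x = algebraMap k[X] (LocalField hp) a + unif hp ^ n * y := by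
  have hP : unif hp ^ n ≠ 0 := pow_ne_zero _ (unif_ne_zero hp)
  obtain ⟨z, hz⟩ := (denseRange_algebraMap (R := k[X]) (RatFunc k) (place hp)).exists_mem_open
    (isClopen_ball_unif hp n x).isOpen ⟨x, by simp [zero_mem]⟩
  have hzx : algebraMap (RatFunc k) (LocalField hp) z
      = x + unif hp ^ n * ((unif hp ^ n)⁻¹ * (algebraMap (RatFunc k) (LocalField hp) z - x)) := by
    rw [mul_inv_cancel_left₀ hP]; ring
  have hPi : unif hp ^ n ∈ (place hp).adicCompletionIntegers (RatFunc k) :=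
    pow_mem (algebraMap_mem_integers hp p) n
  have hz1 : algebraMap (RatFunc k) (LocalField hp) z
      ∈ (place hp).adicCompletionIntegers (RatFunc k) := by
    rw [hzx]
    exact add_mem hx (mul_mem hPi hz)
  have hz2 : (place hp).valuation (RatFunc k) z ≤ 1 := by
    rw [mem_integers_iff] at hz1
    rwa [← valuedAdicCompletion_eq_valuation' (place hp) z]
  obtain ⟨a, ha⟩ := exists_valuation_sub_lt_of_integer (place hp) hz2
    (Units.mk0 (exp (-n : ℤ)) exp_ne_zero)
  have ha' : Valued.v (algebraMap k[X] (LocalField hp) a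
      - algebraMap (RatFunc k) (LocalField hp) z) ≤ exp (-n : ℤ) := by
    rw [IsScalarTower.algebraMap_apply k[X] (RatFunc k) (LocalField hp), ← map_sub]
    exact (valuedAdicCompletion_eq_valuation' (place hp) _).trans_le ha.le
  obtain ⟨y, hy, hay⟩ := unif_pow_dvd hp ha'
  refine ⟨a, -((unif hp ^ n)⁻¹ * (algebraMap (RatFunc k) (LocalField hp) z - x)) - y,
    sub_mem (neg_mem hz) hy, ?_⟩
  rw [mul_sub, ← hay, mul_neg, mul_inv_cancel_left₀ hP]
  ring

theorem pow_dvd_of_algebraMap_eq {a : k[X]} {y : LocalField hp} {n : ℕ}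
    (hy : y ∈ (place hp).adicCompletionIntegers (RatFunc k))
    (h : algebraMap k[X] (LocalField hp) a = unif hp ^ n * y) : p ^ n ∣ a := by
  have h1 : Valued.v (algebraMap k[X] (LocalField hp) a) ≤ exp (-n : ℤ) := by
    rw [h, map_mul, valued_unif_pow]
    exact mul_le_of_le_one_right' ((mem_integers_iff hp).1 hy)
  rw [valued_algebraMap, intValuation_le_pow_iff_dvd] at h1
  rw [← Ideal.span_singleton_le_span_singleton, ← Ideal.span_singleton_pow]
  exact Ideal.le_of_dvd h1

theorem maximalIdeal_eq : IsLocalRing.maximalIdeal (LocalRing hp)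
    = Ideal.span {algebraMap k[X] (LocalRing hp) p} := by
  ext x
  rw [IsLocalRing.mem_maximalIdeal, mem_nonunits_iff,
    adicCompletionIntegers.isUnit_iff_valued_eq_one, Ideal.mem_span_singleton]
  constructor
  · intro h
    have h1 : Valued.v (x : LocalField hp) < 1 := lt_of_le_of_ne ((mem_integers_iff hp).1 x.2) h
    -- The valuation is discrete: a value below `1` is at most that of `p`.
    have h2 : Valued.v (x : LocalField hp) ≤ exp (-(1 : ℕ) : ℤ) := by
      rw [← lt_mul_exp_iff_le exp_ne_zero, ← exp_add]
      simpa using h1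
    obtain ⟨y, hy, hxy⟩ := unif_pow_dvd hp h2
    exact ⟨⟨y, hy⟩, Subtype.ext (by rw [hxy, pow_one]; rfl)⟩
  · rintro ⟨y, rfl⟩ h
    have h1 : Valued.v (unif hp * (y : LocalField hp)) = 1 := h
    rw [map_mul, valued_unif] at h1
    have h2 : exp (-1 : ℤ) * Valued.v (y : LocalField hp) ≤ exp (-1 : ℤ) :=
      mul_le_of_le_one_right' ((mem_integers_iff hp).1 y.2)
    rw [h1, ← exp_zero, exp_le_exp] at h2
    omega

theorem mem_maximalIdeal_pow {x : LocalRing hp} {n : ℕ} :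
    x ∈ IsLocalRing.maximalIdeal (LocalRing hp) ^ n ↔
      (unif hp ^ n)⁻¹ * (x : LocalField hp) ∈ (place hp).adicCompletionIntegers (RatFunc k) := by
  have hP : unif hp ^ n ≠ 0 := pow_ne_zero _ (unif_ne_zero hp)
  rw [maximalIdeal_eq, Ideal.span_singleton_pow, Ideal.mem_span_singleton]
  constructor
  · rintro ⟨y, rfl⟩
    have : ((algebraMap k[X] (LocalRing hp) p ^ n * y : LocalRing hp) : LocalField hp)
        = unif hp ^ n * y := rfl
    rw [this, inv_mul_cancel_left₀ hP]
    exact y.2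
  · intro h
    exact ⟨⟨_, h⟩, Subtype.ext (mul_inv_cancel_left₀ hP _).symm⟩

/-- A sequence coherent modulo powers of the maximal ideal is Cauchy for the valuation, and its
limit stays in the closed balls that express the congruences. Completeness then gives Hensel's
lemma. -/
instance : IsAdicComplete (IsLocalRing.maximalIdeal (LocalRing hp)) (LocalRing hp) where
  prec' f hf := by
    have hf' : ∀ m n, m ≤ n → (unif hp ^ m)⁻¹ * ((f n : LocalField hp) - f m) ∈
        (place hp).adicCompletionIntegers (RatFunc k) := by
      intro m n hmn
      have := (hf hmn).symm
      rw [SModEq.sub_mem, smul_eq_mul, Ideal.mul_top, mem_maximalIdeal_pow] at this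
      exact this
    have hcauchy : CauchySeq fun n => (f n : LocalField hp) := by
      rw [CauchySeq, Valued.cauchy_iff]
      refine ⟨inferInstance, fun γ => ?_⟩
      set g := MonoidWithZeroHom.ValueGroup₀.embedding γ.1 with hg
      have hg0 : g ≠ 0 := by simp [hg]
      -- The `1` makes `exp (-N) < g` strict.
      set N := (1 - log g).toNat with hN
      refine ⟨(fun n => (f n : LocalField hp)) '' Set.Ici N,
        image_mem_map (mem_atTop N), ?_⟩
      rintro _ ⟨n, hn, rfl⟩ _ ⟨m, hm, rfl⟩
      rw [Valuation.restrict_lt_iff_lt_embedding]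
      have h1 := sub_mem (hf' N m hm) (hf' N n hn)
      rw [← mul_sub, sub_sub_sub_cancel_right, mem_integers_iff, map_mul, map_inv₀,
        valued_unif_pow, inv_mul_le_one₀ (by simp)] at h1
      refine h1.trans_lt ?_
      rw [← hg, ← exp_log hg0, exp_lt_exp]
      omega
    obtain ⟨l, hl⟩ := cauchySeq_tendsto_of_complete hcauchy
    have hlm : ∀ m, (unif hp ^ m)⁻¹ * (l - f m) ∈
        (place hp).adicCompletionIntegers (RatFunc k) := fun m =>
      (isClopen_ball_unif hp m (f m)).isClosed.mem_of_tendsto hl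
        (eventually_atTop.2 ⟨m, fun n hn => hf' m n hn⟩)
    have hl0 : l ∈ (place hp).adicCompletionIntegers (RatFunc k) := by
      have := add_mem (hlm 0) (f 0).2
      simpa using this
    refine ⟨⟨l, hl0⟩, fun n => ?_⟩
    apply SModEq.symm
    rw [SModEq.sub_mem, smul_eq_mul, Ideal.mul_top, mem_maximalIdeal_pow]
    exact hlm n

instance : HenselianLocalRing (LocalRing hp) where
  is_henselian f hf a h h' :=
    HenselianRing.is_henselian (I := IsLocalRing.maximalIdeal (LocalRing hp)) f hf a h (h'.map _)

instance [Finite k] : Finite (IsLocalRing.ResidueField (LocalRing hp)) := by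
  let φ : k[X] →+* IsLocalRing.ResidueField (LocalRing hp) :=
    (IsLocalRing.residue _).comp (algebraMap k[X] (LocalRing hp))
  have hφ : φ p = 0 := by
    change IsLocalRing.residue _ _ = 0
    rw [IsLocalRing.residue_eq_zero_iff, maximalIdeal_eq]
    exact Ideal.mem_span_singleton_self _
  have hs : Function.Surjective φ := by
    intro x
    obtain ⟨x, rfl⟩ := IsLocalRing.residue_surjective x
    obtain ⟨a, y, hy, hxy⟩ := exists_algebraMap_add hp x.2 1
    refine ⟨a, ?_⟩
    have : x = algebraMap k[X] (LocalRing hp) a + algebraMap k[X] (LocalRing hp) p * ⟨y, hy⟩ :=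
      Subtype.ext (by rw [hxy, pow_one]; rfl)
    rw [this, map_add, map_mul]
    change φ a = φ a + φ p * _
    rw [hφ, zero_mul, add_zero]
  have : Module.Finite k (AdjoinRoot p) := (AdjoinRoot.powerBasis hp.ne_zero).finite
  have : Finite (k[X] ⧸ Ideal.span {p}) := Module.finite_of_finite k (M := AdjoinRoot p)
  refine Finite.of_surjective (Ideal.Quotient.lift (Ideal.span {p}) φ ?_)
    (Ideal.Quotient.lift_surjective_of_surjective _ _ hs)
  intro a ha
  obtain ⟨b, rfl⟩ := Ideal.mem_span_singleton.1 ha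
  rw [map_mul, hφ, zero_mul]

theorem isUnit_algebraMap_X (hpt : ¬ X ∣ p) : IsUnit (algebraMap k[X] (LocalRing hp) X) := by
  rw [adicCompletionIntegers.isUnit_iff_valued_eq_one]
  change Valued.v (algebraMap k[X] (LocalField hp) X) = 1
  rw [valued_algebraMap, intValuation_eq_one_iff]
  intro h
  have h : p ∣ X := Ideal.mem_span_singleton.1 h
  exact hpt ((hp.associated_of_dvd Polynomial.irreducible_X h).symm.dvd)

end Local

/-! ### Existence of a local splitting. -/

section Existence

variable {k K : Type*} [Field k] [Fintype k] [Field K] [Algebra k K] [FiniteDimensional k K]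

theorem nonempty_localSplitting (d : ℕ) (hd : Module.finrank k K = d) {p : k[X]}
    (hp : Irreducible p) (hpt : ¬ X ∣ p) : Nonempty (LocalSplitting k K d hp) := by
  obtain ⟨r, hr⟩ := exists_hom_matrix d hd (LocalRing hp) (isUnit_algebraMap_X hp hpt)
  let r' := (IsScalarTower.toAlgHom k[X] (LocalRing hp) (LocalField hp)).mapMatrix.comp r
  have hO := orderLift_bijective hd r hr
  have hF := orderLift_bijective hd r' (span_range_mapMatrix r hr)
  -- The splittings over `O` and `F` are compatible. Surjectivity over `O` then lifts an integral
  -- matrix to the local order, and injectivity over `F` identifies the lift with the given element.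
  have hcomp : ∀ x, orderLift r' (localOrderMap k K hp x)
      = (orderLift r x).map (algebraMap (LocalRing hp) (LocalField hp)) := by
    intro x
    induction x using TensorProduct.induction_on with
    | zero =>
      rw [map_zero, map_zero, map_zero]
      exact (Matrix.map_zero _ (map_zero _)).symm
    | add x y hx hy =>
      rw [map_add, map_add, map_add, hx, hy]
      exact (Matrix.map_add _ (map_add _) _ _).symm
    | tmul a x =>
      rw [localOrderMap, Algebra.TensorProduct.map_tmul, orderLift_tmul, orderLift_tmul,
        Matrix.map_smul' _ _ _ (map_mul _)]
      rfl
  refine ⟨⟨AlgEquiv.ofBijective (orderLift r') hF, fun x => ⟨?_, fun h => ?_⟩⟩⟩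
  · rintro ⟨y, rfl⟩ i j
    change orderLift r' (localOrderMap k K hp y) i j ∈ _
    rw [hcomp]
    exact (orderLift r y i j).2
  · obtain ⟨y, hy⟩ := hO.2 (Matrix.of fun i j => ⟨_, h i j⟩)
    refine ⟨y, hF.1 ?_⟩
    change orderLift r' (localOrderMap k K hp y) = _
    rw [hcomp, hy]
    rfl

end Existence

/-! ### `K{τ}` inside the local order. -/

section LocalOrder

variable {k K : Type*} [Field k] [Fintype k] [Field K] [Algebra k K] [FiniteDimensional k K]
  {d : ℕ} {p : k[X]} {hp : Irreducible p}

/-- The subring `M(d, k[t]_p)` of `M(d, k(t)_p)`. -/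
def integralMatrices (d : ℕ) {p : k[X]} (hp : Irreducible p) :
    Subring (Matrix (Fin d) (Fin d) (LocalField hp)) :=
  ((place hp).adicCompletionIntegers (RatFunc k)).toSubring.matrix

omit [Fintype k] in
theorem smul_mem_integralMatrices {M : Matrix (Fin d) (Fin d) (LocalField hp)} {c : LocalField hp}
    (hc : c ∈ (place hp).adicCompletionIntegers (RatFunc k)) (hM : M ∈ integralMatrices d hp) :
    c • M ∈ integralMatrices d hp := fun i j =>
  ((place hp).adicCompletionIntegers (RatFunc k)).mul_mem _ _ hc (hM i j)

omit [Fintype k] in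
theorem exists_pow_smul_mem (M : Matrix (Fin d) (Fin d) (LocalField hp)) :
    ∃ n : ℕ, unif hp ^ n • M ∈ integralMatrices d hp := by
  choose n hn using fun i j => exists_pow_mul_mem hp (M i j)
  refine ⟨Finset.univ.sup fun i => Finset.univ.sup fun j => n i j, fun i j => hn i j _ ?_⟩
  exact (Finset.le_sup (f := fun j => n i j) (Finset.mem_univ j)).trans
    (Finset.le_sup (f := fun i => Finset.univ.sup fun j => n i j) (Finset.mem_univ i))

/-- The embedding `K{τ} → M(d, k(t)_p)`. -/
def LocalSplitting.skewHom (φ : LocalSplitting k K d hp) :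
    SkewPoly k K →+* Matrix (Fin d) (Fin d) (LocalField hp) :=
  φ.toAlgEquiv.toRingEquiv.toRingHom.comp
    (Algebra.TensorProduct.includeRight :
      SkewPoly k K →ₐ[k[X]] Order k K (LocalField hp)).toRingHom

theorem LocalSplitting.skewHom_apply (φ : LocalSplitting k K d hp) (r : SkewPoly k K) :
    φ.skewHom r = φ.toAlgEquiv (1 ⊗ₜ r) := rfl

theorem LocalSplitting.skewHom_smul (φ : LocalSplitting k K d hp) (f : k[X]) (r : SkewPoly k K) :
    φ.skewHom (f • r) = algebraMap k[X] (LocalField hp) f • φ.skewHom r := by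
  rw [skewHom_apply, skewHom_apply, ← map_smul, tmul_smul, algebraMap_smul]

theorem LocalSplitting.skewHom_pow_smul (φ : LocalSplitting k K d hp) (n : ℕ) (r : SkewPoly k K) :
    φ.skewHom (p ^ n • r) = unif hp ^ n • φ.skewHom r := by
  rw [skewHom_smul, map_pow]
  rfl

theorem LocalSplitting.skewHom_algebraMap_pow (φ : LocalSplitting k K d hp) (n : ℕ) :
    φ.skewHom (algebraMap k[X] _ (p ^ n)) = unif hp ^ n • 1 := by
  rw [Algebra.algebraMap_eq_smul_one, skewHom_pow_smul, map_one]

omit [Fintype k] in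
theorem algebraMap_localField_injective :
    Function.Injective (algebraMap k[X] (LocalField hp)) := by
  rw [IsScalarTower.algebraMap_eq k[X] (RatFunc k) (LocalField hp)]
  exact (algebraMap (RatFunc k) (LocalField hp)).injective.comp
    (IsFractionRing.injective k[X] (RatFunc k))

theorem LocalSplitting.skewHom_injective (φ : LocalSplitting k K d hp) :
    Function.Injective φ.skewHom :=
  φ.toAlgEquiv.injective.comp
    (Algebra.TensorProduct.includeRight_injective algebraMap_localField_injective)

theorem LocalSplitting.skewHom_mem (φ : LocalSplitting k K d hp) (r : SkewPoly k K) :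
    φ.skewHom r ∈ integralMatrices d hp := by
  refine (φ.map_order _).1 ⟨1 ⊗ₜ r, ?_⟩
  rw [localOrderMap]
  exact (Algebra.TensorProduct.map_tmul _ _ _ _).trans (by rw [map_one]; rfl)

theorem localOrderMap_tmul (a : LocalRing hp) (r : SkewPoly k K) :
    localOrderMap k K hp (a ⊗ₜ r) = (a : LocalField hp) ⊗ₜ r :=
  Algebra.TensorProduct.map_tmul _ _ _ _

/-- `K{τ}` is dense in the local order. -/
theorem LocalSplitting.exists_skewHom_eq_add (φ : LocalSplitting k K d hp)
    {M : Matrix (Fin d) (Fin d) (LocalField hp)} (hM : M ∈ integralMatrices d hp) (n : ℕ) :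
    ∃ r, ∃ N ∈ integralMatrices d hp, φ.skewHom r = M + unif hp ^ n • N := by
  obtain ⟨x, rfl⟩ := φ.toAlgEquiv.surjective M
  obtain ⟨y, rfl⟩ := (φ.map_order x).2 hM
  suffices h : ∃ r, ∃ z, (1 : LocalField hp) ⊗ₜ[k[X]] r
      = localOrderMap k K hp y + unif hp ^ n • localOrderMap k K hp z by
    obtain ⟨r, z, h⟩ := h
    exact ⟨r, φ.toAlgEquiv (localOrderMap k K hp z), (φ.map_order _).1 ⟨z, rfl⟩, by
      rw [skewHom_apply, h, map_add, map_smul]; rfl⟩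
  clear hM
  induction y using TensorProduct.induction_on with
  | zero => exact ⟨0, 0, by simp⟩
  | add y y' h h' =>
    obtain ⟨r, z, h⟩ := h
    obtain ⟨r', z', h'⟩ := h'
    exact ⟨r + r', z + z', by rw [tmul_add, h, h', map_add, map_add, smul_add]; abel⟩
  | tmul a s =>
    -- With `a = b + p ^ n c`, the polynomial `b` is moved across the tensor product, leaving the
    -- error `-(c ⊗ s)`.
    obtain ⟨b, c, hc, hac⟩ := exists_algebraMap_add hp a.2 n
    refine ⟨b • s, -((⟨c, hc⟩ : LocalRing hp) ⊗ₜ s), ?_⟩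
    rw [map_neg, localOrderMap_tmul, localOrderMap_tmul, hac, smul_neg, smul_tmul', smul_eq_mul,
      add_tmul, add_neg_cancel_right, tmul_smul, smul_tmul', Algebra.algebraMap_eq_smul_one]

/-- In a `k[t]`-basis of `K{τ}`, elements of the local order have integral coordinates. The
coordinates of `r` are thus polynomials in `p ^ n O`, hence divisible by `p ^ n`. -/
theorem LocalSplitting.exists_eq_pow_smul (φ : LocalSplitting k K d hp) {r : SkewPoly k K} {n : ℕ}
    {N : Matrix (Fin d) (Fin d) (LocalField hp)} (hN : N ∈ integralMatrices d hp)
    (h : φ.skewHom r = unif hp ^ n • N) : ∃ s, r = p ^ n • s := by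
  obtain ⟨x, rfl⟩ := φ.toAlgEquiv.surjective N
  obtain ⟨y, hy⟩ := (φ.map_order x).2 hN
  rw [skewHom_apply, ← map_smul] at h
  have h := φ.toAlgEquiv.injective h
  let e := Module.Free.chooseBasis k[X] (SkewPoly k K)
  let E := Algebra.TensorProduct.basis (LocalField hp) e
  have hint : ∀ y : Order k K (LocalRing hp), ∀ i, E.repr (localOrderMap k K hp y) i ∈
      (place hp).adicCompletionIntegers (RatFunc k) := by
    intro y i
    induction y using TensorProduct.induction_on with
    | zero => rw [map_zero, map_zero]; exact zero_mem _
    | add y y' h h' =>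
      rw [map_add, map_add, Finsupp.add_apply]
      exact add_mem h h'
    | tmul a s =>
      rw [localOrderMap_tmul, Algebra.TensorProduct.basis_repr_tmul]
      exact mul_mem a.2 (algebraMap_mem_integers hp _)
  have hdvd : ∀ i, p ^ n ∣ e.repr r i := by
    intro i
    refine pow_dvd_of_algebraMap_eq hp (hint y i) ?_
    have := congrArg (fun z => E.repr z i) h
    rw [← hy] at this
    simp only [map_smul, E, Algebra.TensorProduct.basis_repr_tmul, one_smul,
      Finsupp.mapRange_apply, Finsupp.smul_apply, smul_eq_mul] at this
    exact this
  choose q hq using hdvd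
  refine ⟨∑ i, q i • e i, ?_⟩
  rw [Finset.smul_sum, ← e.sum_repr r]
  refine Finset.sum_congr rfl fun i _ => ?_
  rw [hq, mul_smul]

end LocalOrder

/-! ### The standard lattice and scalar matrices. -/

section StandardLattice

variable (O F : Type*) [CommRing O] [Field F] [Algebra O F] (d : ℕ)

/-- The lattice `O ^ d`. -/
def stdLattice : Lattice O F d :=
  ⟨Submodule.span O (Set.range (Pi.basisFun F (Fin d))), Pi.basisFun F (Fin d), rfl⟩

variable {O F d}

theorem mem_stdLattice {v : Fin d → F} :
    v ∈ (stdLattice O F d).1 ↔ ∀ i, v i ∈ (algebraMap O F).range := by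
  constructor
  · intro hv i
    change v ∈ Submodule.span O _ at hv
    induction hv using Submodule.span_induction with
    | zero => exact zero_mem _
    | add v w _ _ hv hw => exact add_mem hv hw
    | smul a v _ hv =>
      rw [Pi.smul_apply, Algebra.smul_def]
      exact mul_mem ⟨a, rfl⟩ hv
    | mem v hv =>
      obtain ⟨j, rfl⟩ := hv
      rw [Pi.basisFun_apply, Pi.single_apply]
      split_ifs
      exacts [one_mem _, zero_mem _]
  · intro hv
    choose a ha using hv
    change v ∈ Submodule.span O _
    rw [← (Pi.basisFun F (Fin d)).sum_repr v]
    refine sum_mem fun i _ => ?_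
    rw [Pi.basisFun_repr, ← ha, algebraMap_smul]
    exact Submodule.smul_mem _ _ (Submodule.subset_span ⟨i, rfl⟩)

theorem exists_smul_stdLattice (L : Lattice O F d) :
    ∃ g : GL (Fin d) F, L = g • stdLattice O F d := by
  obtain ⟨L, b, rfl⟩ := L
  let e := (Pi.basisFun F (Fin d)).equiv b (Equiv.refl _)
  let g := (Matrix.GeneralLinearGroup.toLin (R := F) (n := Fin d)).symm
    (LinearMap.GeneralLinearGroup.ofLinearEquiv e)
  refine ⟨g, Subtype.ext ?_⟩
  change Submodule.span O (Set.range b) = (Submodule.span O _).map (glMap O g)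
  rw [Submodule.map_span, ← Set.range_comp]
  congr 2
  ext1 i
  have : glMap O g (Pi.basisFun F (Fin d) i)
      = (Matrix.GeneralLinearGroup.toLin g : (Fin d → F) →ₗ[F] _) (Pi.basisFun F (Fin d) i) := rfl
  rw [Function.comp_apply, this, MulEquiv.apply_symm_apply]
  exact ((Pi.basisFun F (Fin d)).equiv_apply i b (Equiv.refl _)).symm

theorem mem_range_of_smul_stdLattice {g : GL (Fin d) F}
    (h : g • stdLattice O F d = stdLattice O F d) (i j : Fin d) :
    (g : Matrix (Fin d) (Fin d) F) i j ∈ (algebraMap O F).range := by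
  have h1 : Pi.basisFun F (Fin d) j ∈ (stdLattice O F d).1 := Submodule.subset_span ⟨j, rfl⟩
  have h2 : glMap O g (Pi.basisFun F (Fin d) j) ∈ (g • stdLattice O F d).1 := ⟨_, h1, rfl⟩
  rw [h, mem_stdLattice] at h2
  have h3 := h2 i
  rw [Pi.basisFun_apply] at h3
  change ((g : Matrix (Fin d) (Fin d) F).mulVec (Pi.single j 1)) i ∈ _ at h3
  rwa [Matrix.mulVec_single_one] at h3

theorem smul_stdLattice_le {g : GL (Fin d) F}
    (h : ∀ i j, (g : Matrix (Fin d) (Fin d) F) i j ∈ (algebraMap O F).range) :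
    (g • stdLattice O F d).1 ≤ (stdLattice O F d).1 := by
  rintro _ ⟨v, hv, rfl⟩
  rw [SetLike.mem_coe, mem_stdLattice] at hv
  rw [mem_stdLattice]
  intro i
  change ∑ j, (g : Matrix (Fin d) (Fin d) F) i j * v j ∈ _
  exact sum_mem fun j _ => mul_mem (h i j) (hv j)

theorem smul_stdLattice_eq {g : GL (Fin d) F}
    (h : ∀ i j, (g : Matrix (Fin d) (Fin d) F) i j ∈ (algebraMap O F).range)
    (h' : ∀ i j, ((g⁻¹ : GL (Fin d) F) : Matrix (Fin d) (Fin d) F) i j ∈ (algebraMap O F).range) :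
    g • stdLattice O F d = stdLattice O F d := by
  refine Subtype.ext (le_antisymm (smul_stdLattice_le h) ?_)
  have := Submodule.map_mono (f := glMap O g) (smul_stdLattice_le h')
  refine le_trans (le_of_eq ?_) this
  change _ = (g • g⁻¹ • stdLattice O F d).1
  rw [smul_inv_smul]

/-- The scalar matrix `c`. -/
def scalarGL (c : Fˣ) : GL (Fin d) F :=
  Units.map (algebraMap F (Matrix (Fin d) (Fin d) F)).toMonoidHom c

theorem coe_scalarGL_mul (c : Fˣ) (g : GL (Fin d) F) :
    ((scalarGL c * g : GL (Fin d) F) : Matrix (Fin d) (Fin d) F)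
      = (c : F) • (g : Matrix (Fin d) (Fin d) F) := by
  rw [Algebra.smul_def]
  rfl

theorem scalarGL_smul (c : Fˣ) (x : BuildingVertex O F d) : scalarGL (d := d) c • x = x :=
  scalar_smul (c : F) _ rfl c.ne_zero x

theorem exists_scalarGL_smul_eq {L L' : Lattice O F d} (h : L ≈ L') :
    ∃ c : Fˣ, L' = scalarGL (d := d) c • L := by
  obtain ⟨c, hc⟩ := h
  refine ⟨c, Subtype.ext ?_⟩
  rw [hc]
  have hv : ∀ v, glMap O (scalarGL c) v = (c : F) • v := fun v => by
    change (algebraMap F (Matrix (Fin d) (Fin d) F) c).mulVec v = (c : F) • v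
    rw [Algebra.algebraMap_eq_smul_one, Matrix.smul_mulVec, Matrix.one_mulVec]
  change _ = L.1.map (glMap O (scalarGL c))
  ext v
  simp only [Submodule.mem_map, Submodule.mem_smul_pointwise_iff_exists, hv]

end StandardLattice

/-! ### Transitivity and stabilizers. -/

section SimplyTransitive

variable {k K : Type*} [Field k] [Fintype k] [Field K] [Algebra k K] [FiniteDimensional k K]
  {d : ℕ} {p : k[X]} {hp : Irreducible p}

omit [FiniteDimensional k K] in
theorem constCoeff_const (a : FrobField k K) : constCoeff k K (const k K a) = a :=
  SkewPolynomial.coeff_C_zero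

omit [Fintype k] in
theorem mem_range_algebraMap_iff {x : LocalField hp} :
    x ∈ (algebraMap (LocalRing hp) (LocalField hp)).range ↔
      x ∈ (place hp).adicCompletionIntegers (RatFunc k) :=
  ⟨fun ⟨y, hy⟩ => hy ▸ y.2, fun h => ⟨⟨x, h⟩, rfl⟩⟩

omit [Fintype k] in
theorem stdLattice_smul_eq {g : GL (Fin d) (LocalField hp)}
    (h : (g : Matrix (Fin d) (Fin d) (LocalField hp)) ∈ integralMatrices d hp)
    (h' : ((g⁻¹ : GL (Fin d) (LocalField hp)) : Matrix (Fin d) (Fin d) (LocalField hp))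
      ∈ integralMatrices d hp) :
    g • stdLattice (LocalRing hp) (LocalField hp) d = stdLattice (LocalRing hp) (LocalField hp) d :=
  smul_stdLattice_eq (fun i j => mem_range_algebraMap_iff.2 (h i j))
    (fun i j => mem_range_algebraMap_iff.2 (h' i j))

omit [Fintype k] in
theorem mem_of_stdLattice_smul_eq {g : GL (Fin d) (LocalField hp)}
    (h : g • stdLattice (LocalRing hp) (LocalField hp) d
      = stdLattice (LocalRing hp) (LocalField hp) d) :
    (g : Matrix (Fin d) (Fin d) (LocalField hp)) ∈ integralMatrices d hp :=
  fun i j => mem_range_algebraMap_iff.1 (mem_range_of_smul_stdLattice h i j)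

/-- A factor of a power of `p` is a unit in `K{τ}[1/p]`. -/
def unitOfMulEq {f f' : SkewPoly k K} {n : ℕ} (h : f * f' = algebraMap k[X] _ (p ^ n))
    (h' : f' * f = algebraMap k[X] _ (p ^ n)) : (OrderAway k K p)ˣ where
  val := 1 ⊗ₜ f
  inv := (IsLocalization.Away.invSelf p ^ n) ⊗ₜ f'
  val_inv := by
    rw [Algebra.TensorProduct.tmul_mul_tmul, h, one_mul, Algebra.algebraMap_eq_smul_one, tmul_smul,
      smul_tmul', Algebra.smul_def, map_pow, ← mul_pow, IsLocalization.Away.mul_invSelf, one_pow,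
      Algebra.TensorProduct.one_def]
  inv_val := by
    rw [Algebra.TensorProduct.tmul_mul_tmul, h', mul_one, Algebra.algebraMap_eq_smul_one, tmul_smul,
      smul_tmul', Algebra.smul_def, map_pow, ← mul_pow, IsLocalization.Away.mul_invSelf, one_pow,
      Algebra.TensorProduct.one_def]

theorem orderAwayToLocal_tmul (z : Localization.Away p) (r : SkewPoly k K) :
    orderAwayToLocal k K hp (z ⊗ₜ r) = awayToLocal k hp z ⊗ₜ r :=
  Algebra.TensorProduct.map_tmul _ _ _ _

theorem LocalSplitting.map_one_tmul (φ : LocalSplitting k K d hp) (r : SkewPoly k K) :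
    φ.toAlgEquiv (orderAwayToLocal k K hp (1 ⊗ₜ r)) = φ.skewHom r := by
  rw [orderAwayToLocal_tmul, map_one, skewHom_apply]

/-- Right multiplication by a constant makes the constant coefficient equal to `1`. -/
theorem exists_normalized_generator (hpt : ¬ X ∣ p) {f f' : SkewPoly k K} {n : ℕ}
    (h : f * f' = algebraMap k[X] _ (p ^ n)) :
    ∃ g g' : SkewPoly k K, g * g' = algebraMap k[X] _ (p ^ n) ∧
      g' * g = algebraMap k[X] _ (p ^ n) ∧ constCoeff k K g = 1 ∧ ∃ c c', c * c' = 1 ∧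
      g = f * c ∧ f = g * c' := by
  have hp0 : p ≠ 0 := by
    rintro rfl
    exact hpt (dvd_zero _)
  have hpn : algebraMap k[X] (SkewPoly k K) (p ^ n) ≠ 0 := by
    rw [← map_zero (algebraMap k[X] (SkewPoly k K))]
    exact algebraMap_skewPoly_injective.ne (pow_ne_zero _ hp0)
  have hf0 : f ≠ 0 := by
    rintro rfl
    exact hpn (by rw [← h, zero_mul])
  -- `p ^ n` is central and `K{τ}` is a domain, so a one-sided factorization is two-sided.
  have h' : f' * f = algebraMap k[X] _ (p ^ n) := by
    apply mul_left_cancel₀ hf0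
    rw [← mul_assoc, h, Algebra.commutes]
  -- Otherwise `p(0) ^ n = 0`, although `t` does not divide `p`.
  have hc : constCoeff k K f ≠ 0 := by
    intro h0
    have := congrArg (constCoeff k K) h
    rw [map_mul, h0, zero_mul, constCoeff_algebraMap, eval_pow] at this
    have h1 := isUnit_eval_zero hpt
    rw [isUnit_iff_ne_zero, coe_evalRingHom] at h1
    exact pow_ne_zero n h1 ((algebraMap k K).injective (by rw [map_zero, ← this]))
  let c : FrobField k K := constCoeff k K f
  have hc' : c ≠ 0 := hc
  have h1 : const k K c⁻¹ * const k K c = 1 := by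
    rw [← map_mul, inv_mul_cancel₀ hc', map_one]
  refine ⟨f * const k K c⁻¹, const k K c * f', ?_, ?_, ?_, const k K c⁻¹, const k K c, h1, rfl, ?_⟩
  · rw [mul_assoc, ← mul_assoc (const k K c⁻¹), h1, one_mul, h]
  · rw [mul_assoc, ← mul_assoc f', h', Algebra.commutes, ← mul_assoc, ← map_mul,
      mul_inv_cancel₀ hc', map_one, one_mul]
  · rw [map_mul, constCoeff_const]
    exact mul_inv_cancel₀ hc
  · rw [mul_assoc, h1, mul_one]

variable (hp d) in
/-- The vertex of the standard lattice. -/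
def stdVertex : BuildingVertex (LocalRing hp) (LocalField hp) d := Quotient.mk _ (stdLattice _ _ d)

theorem exists_gammaTau_smul_eq (hpt : ¬ X ∣ p) (φ : LocalSplitting k K d hp)
    (x : BuildingVertex (LocalRing hp) (LocalField hp) d) :
    ∃ γ ∈ GammaTau k K hpt, φ.vertexAction γ (stdVertex d hp) = x := by
  obtain ⟨L⟩ := x
  obtain ⟨h, rfl⟩ := exists_smul_stdLattice L
  -- Rescaling `h` to an integral matrix `G` does not move the vertex.
  obtain ⟨N, hN⟩ := exists_pow_smul_mem (h : Matrix (Fin d) (Fin d) (LocalField hp))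
  have hP : unif hp ^ N ≠ 0 := pow_ne_zero _ (unif_ne_zero hp)
  let z : (LocalField hp)ˣ := Units.mk0 _ hP
  let G : GL (Fin d) (LocalField hp) := scalarGL z * h
  have hG : (G : Matrix (Fin d) (Fin d) (LocalField hp)) ∈ integralMatrices d hp := by
    rw [coe_scalarGL_mul]
    exact hN
  let H : Matrix (Fin d) (Fin d) (LocalField hp) :=
    ((G⁻¹ : GL (Fin d) (LocalField hp)) : Matrix _ _ _)
  have hHG : H * (G : Matrix (Fin d) (Fin d) (LocalField hp)) = 1 := Units.inv_mul G
  have hGH : (G : Matrix (Fin d) (Fin d) (LocalField hp)) * H = 1 := Units.mul_inv G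
  obtain ⟨M, hM⟩ := exists_pow_smul_mem H
  -- The right ideal of all `r` whose image lies in `G M(d, O)`.
  let I : AddSubgroup (SkewPoly k K) := (integralMatrices d hp).toAddSubgroup.comap
    ((AddMonoidHom.mulLeft H).comp φ.skewHom.toAddMonoidHom)
  have hI : ∀ r, r ∈ I ↔ H * φ.skewHom r ∈ integralMatrices d hp := fun r => Iff.rfl
  obtain ⟨f, hfI, hf⟩ := exists_generator I fun r hr s => by
    rw [hI, map_mul, ← mul_assoc]
    exact mul_mem ((hI r).1 hr) (φ.skewHom_mem s)
  -- `p ^ M` clears the denominators of `G⁻¹`, so it lies in `I`; hence `f` divides it.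
  obtain ⟨f', hff'⟩ := hf (algebraMap k[X] _ (p ^ M)) (by
    rw [hI, φ.skewHom_algebraMap_pow, mul_smul_comm, mul_one]
    exact hM)
  obtain ⟨g, g', hgg', hg'g, hg1, c, c', hcc', hgc, hfc⟩ :=
    exists_normalized_generator hpt hff'.symm
  let γ := unitOfMulEq hgg' hg'g
  have hγ : ((φ.toGL γ : GL (Fin d) (LocalField hp)) : Matrix (Fin d) (Fin d) (LocalField hp))
      = φ.skewHom g := φ.map_one_tmul g
  refine ⟨QuotientGroup.mk γ, ?_, ?_⟩
  · rw [GammaTau, MonoidHom.mem_ker]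
    change QuotientGroup.mk (Units.map (evalTauZero k K hpt).toMonoidHom γ) = _
    have : Units.map (evalTauZero k K hpt).toMonoidHom γ = 1 := by
      ext
      change evalTauZero k K hpt (1 ⊗ₜ g) = 1
      rw [evalTauZero_tmul, map_one, map_one, one_mul, hg1]
    rw [this]
    rfl
  · rw [φ.vertexAction_mk]
    let W : Matrix (Fin d) (Fin d) (LocalField hp) := H * φ.skewHom g
    have hW : W ∈ integralMatrices d hp := by
      change H * φ.skewHom g ∈ _
      rw [hgc, map_mul, ← mul_assoc]
      exact mul_mem ((hI f).1 hfI) (φ.skewHom_mem c)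
    -- It remains to invert `W = G⁻¹ g` integrally, that is, to write `G = g W'`. Approximate `G` by
    -- `r = G + p ^ M N₀`. Then `r ∈ I`, so `r = f r' = g c' r'`, while `p ^ M = g g'`; this gives
    -- `W' = c' r' - g' N₀`.
    obtain ⟨r, N₀, hN₀, hr⟩ := φ.exists_skewHom_eq_add hG M
    obtain ⟨r', hr'⟩ := hf r (by
      rw [hI, hr, mul_add, hHG, mul_smul_comm, ← smul_mul_assoc]
      exact add_mem (one_mem _) (mul_mem hM hN₀))
    let W' : Matrix (Fin d) (Fin d) (LocalField hp) :=
      φ.skewHom (c' * r') - φ.skewHom g' * N₀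
    have hW' : W' ∈ integralMatrices d hp :=
      sub_mem (φ.skewHom_mem _) (mul_mem (φ.skewHom_mem _) hN₀)
    have hGW : φ.skewHom g * W' = G := by
      change φ.skewHom g * (φ.skewHom (c' * r') - φ.skewHom g' * N₀) = G
      rw [mul_sub, ← map_mul, ← mul_assoc g, ← hfc, ← hr', hr, ← mul_assoc, ← map_mul, hgg',
        φ.skewHom_algebraMap_pow, smul_mul_assoc, one_mul, add_sub_cancel_right]
    have hWW' : W * W' = 1 := by
      change H * φ.skewHom g * W' = 1
      rw [mul_assoc, hGW, hHG]
    let u : GL (Fin d) (LocalField hp) := ⟨W, W', hWW', mul_eq_one_comm.1 hWW'⟩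
    have hu : u • stdLattice (LocalRing hp) (LocalField hp) d = stdLattice _ _ d :=
      stdLattice_smul_eq hW hW'
    have hGu : φ.toGL γ = scalarGL z * (h * u) := by
      rw [← mul_assoc]
      ext1
      rw [hγ]
      change φ.skewHom g = (G : Matrix (Fin d) (Fin d) (LocalField hp)) * (H * φ.skewHom g)
      rw [← mul_assoc, hGH, one_mul]
    rw [hGu, mul_smul, scalarGL_smul, mul_smul]
    exact congrArg (fun L => (Quotient.mk _ (h • L) : BuildingVertex (LocalRing hp) _ d)) hu

/-- An element of `K{τ}[1/p]` which is integral at `p` is in `K{τ}`. -/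
theorem LocalSplitting.exists_eq_one_tmul (φ : LocalSplitting k K d hp) (x : OrderAway k K p)
    (hx : φ.toAlgEquiv (orderAwayToLocal k K hp x) ∈ integralMatrices d hp) :
    ∃ s : SkewPoly k K, x = 1 ⊗ₜ s := by
  have hden : ∃ (n : ℕ) (r : SkewPoly k K), p ^ n • x = 1 ⊗ₜ r := by
    clear hx
    induction x using TensorProduct.induction_on with
    | zero => exact ⟨0, 0, by simp⟩
    | add x y hx hy =>
      obtain ⟨n, r, hx⟩ := hx
      obtain ⟨m, s, hy⟩ := hy
      refine ⟨n + m, p ^ m • r + p ^ n • s, ?_⟩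
      rw [smul_add, tmul_add, tmul_smul, tmul_smul, ← hx, ← hy, smul_smul, smul_smul, pow_add,
        mul_comm (p ^ m)]
    | tmul a s =>
      obtain ⟨n, b, hb⟩ := IsLocalization.Away.surj p a
      refine ⟨n, b • s, ?_⟩
      rw [smul_tmul', tmul_smul, smul_tmul', Algebra.smul_def, map_pow, mul_comm, hb,
        Algebra.algebraMap_eq_smul_one]
  obtain ⟨n, r, hr⟩ := hden
  -- After clearing denominators, integrality of `x` says that `r` is divisible by `p ^ n` locally,
  -- hence in `K{τ}`.
  have h1 : φ.skewHom r = unif hp ^ n • φ.toAlgEquiv (orderAwayToLocal k K hp x) := by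
    rw [← φ.map_one_tmul, ← hr, map_smul, ← map_smul φ.toAlgEquiv,
      ← algebraMap_smul (LocalField hp) (p ^ n), map_pow]
    rfl
  obtain ⟨s, rfl⟩ := φ.exists_eq_pow_smul hx h1
  refine ⟨s, ?_⟩
  have hu : IsUnit (algebraMap k[X] (Localization.Away p) (p ^ n)) := by
    rw [map_pow]
    exact IsLocalization.Away.algebraMap_pow_isUnit p n
  have e : ∀ y : OrderAway k K p,
      p ^ n • y = algebraMap k[X] (Localization.Away p) (p ^ n) • y :=
    fun y => (algebraMap_smul _ _ y).symm
  rw [tmul_smul, e, e] at hr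
  exact hu.smul_left_cancel.1 hr

theorem LocalSplitting.toGL_scalar (φ : LocalSplitting k K d hp) (z : (Localization.Away p)ˣ) :
    φ.toGL (Units.map (algebraMap (Localization.Away p) (OrderAway k K p)).toMonoidHom z)
      = scalarGL (Units.map (awayToLocal k hp).toRingHom.toMonoidHom z) := by
  ext1
  change φ.toAlgEquiv (orderAwayToLocal k K hp ((z : Localization.Away p) ⊗ₜ 1)) = _
  rw [orderAwayToLocal_tmul]
  exact φ.toAlgEquiv.commutes _

omit [Fintype k] in
theorem scalarGL_mul_mem_integralMatrices {e : (LocalField hp)ˣ}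
    (he : Valued.v (e : LocalField hp) = 1)
    {g : GL (Fin d) (LocalField hp)}
    (h : (g : Matrix (Fin d) (Fin d) (LocalField hp)) ∈ integralMatrices d hp) :
    ((scalarGL e * g : GL (Fin d) (LocalField hp)) : Matrix (Fin d) (Fin d) (LocalField hp))
      ∈ integralMatrices d hp := by
  rw [coe_scalarGL_mul]
  exact smul_mem_integralMatrices ((mem_integers_iff hp).2 he.le) h

variable (p) in
/-- The unit `p` of `k[t][1/p]`. -/
def awayUnit : (Localization.Away p)ˣ := (IsLocalization.Away.algebraMap_isUnit p).unit

/-- A unit of `K{τ}[1/p]` integral at `p` along with its inverse is a constant. -/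
theorem LocalSplitting.exists_const_of_integral (φ : LocalSplitting k K d hp)
    (g : (OrderAway k K p)ˣ)
    (h : (φ.toGL g : Matrix (Fin d) (Fin d) (LocalField hp)) ∈ integralMatrices d hp)
    (h' : (φ.toGL g⁻¹ : Matrix (Fin d) (Fin d) (LocalField hp)) ∈ integralMatrices d hp) :
    ∃ a, (g : OrderAway k K p) = 1 ⊗ₜ const k K a := by
  obtain ⟨s, hs⟩ := φ.exists_eq_one_tmul g h
  obtain ⟨s', hs'⟩ := φ.exists_eq_one_tmul _ h'
  have hss' : s * s' = 1 := by
    apply φ.skewHom_injective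
    rw [map_one, map_mul, ← φ.map_one_tmul, ← φ.map_one_tmul, ← hs, ← hs', ← map_mul, ← map_mul,
      Units.mul_inv, map_one, map_one]
  obtain ⟨a, rfl⟩ := exists_const_of_mul_eq_one hss'
  exact ⟨a, hs⟩

/-- Evaluation at `τ = 0` returns `a` itself, so the kernel condition puts `a` in `kˣ`, which
consists of scalars from `Z`. -/
theorem mk_eq_one_of_const (hpt : ¬ X ∣ p) {g : (OrderAway k K p)ˣ} {a : FrobField k K}
    (hg : (g : OrderAway k K p) = 1 ⊗ₜ const k K a)
    (h : (QuotientGroup.mk g : GammaOne k K p) ∈ GammaTau k K hpt) :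
    (QuotientGroup.mk g : GammaOne k K p) = 1 := by
  rw [GammaTau, MonoidHom.mem_ker] at h
  obtain ⟨b, hb⟩ := (QuotientGroup.eq_one_iff
    (Units.map (evalTauZero k K hpt).toMonoidHom g)).1 h
  have hab : algebraMap k K b = a := by
    have := congrArg Units.val hb
    change algebraMap k K b = evalTauZero k K hpt g at this
    rw [this, hg, evalTauZero_tmul, map_one, map_one, one_mul, constCoeff_const]
  refine (QuotientGroup.eq_one_iff g).2 ⟨Units.map ((algebraMap k[X] (Localization.Away p)).comp
    C).toMonoidHom b, ?_⟩
  ext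
  change (algebraMap k[X] (Localization.Away p) (C (b : k))) ⊗ₜ 1 = (g : OrderAway k K p)
  rw [hg, ← hab, Algebra.algebraMap_eq_smul_one, smul_tmul, ← Algebra.algebraMap_eq_smul_one,
    algebraMap_C]
  rfl

theorem eq_one_of_smul_stdLattice (hpt : ¬ X ∣ p) (φ : LocalSplitting k K d hp)
    {γ : GammaOne k K p} (hγ : γ ∈ GammaTau k K hpt)
    (h : φ.vertexAction γ (stdVertex d hp) = stdVertex d hp) : γ = 1 := by
  obtain ⟨g, rfl⟩ := QuotientGroup.mk_surjective γ
  rw [φ.vertexAction_mk] at h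
  obtain ⟨c, hc⟩ := exists_scalarGL_smul_eq (Quotient.exact h)
  rw [← mul_smul] at hc
  -- `c g` stabilizes `O^d`, but `c` need not come from `Z`. Replace it by the power `w` of `p` with
  -- the same valuation: `w g = e (c g)` with `e = w c⁻¹` a unit of `O`, and `w g` has the class of
  -- `g` in `Γ(1)`.
  obtain ⟨n, hn⟩ := exists_zpow_mul_valued_eq_one hp c.ne_zero
  let z : (Localization.Away p)ˣ := awayUnit p ^ (-n)
  let w : (LocalField hp)ˣ := Units.map (awayToLocal k hp).toRingHom.toMonoidHom z
  have hw : (w : LocalField hp) = unif hp ^ (-n) := by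
    change ((Units.map (awayToLocal k hp).toRingHom.toMonoidHom (awayUnit p ^ (-n)) :
      (LocalField hp)ˣ) : LocalField hp) = _
    rw [map_zpow, Units.val_zpow_eq_zpow_val]
    congr 1
    exact (awayToLocal k hp).commutes p
  let e : (LocalField hp)ˣ := w * c⁻¹
  have he : Valued.v (e : LocalField hp) = 1 := by
    rw [← inv_one, ← hn, ← map_inv₀, mul_inv, ← zpow_neg, ← hw, ← Units.val_inv_eq_inv_val]
    rfl
  have he' : Valued.v ((e⁻¹ : (LocalField hp)ˣ) : LocalField hp) = 1 := by
    rw [Units.val_inv_eq_inv_val, map_inv₀, he, inv_one]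
  let Z := Units.map (algebraMap (Localization.Away p) (OrderAway k K p)).toMonoidHom z
  have hZg : φ.toGL (Z * g) = scalarGL e * (scalarGL c * φ.toGL g) := by
    rw [map_mul, φ.toGL_scalar, ← mul_assoc]
    congr 1
    change scalarGL w = _
    rw [scalarGL, scalarGL, scalarGL, ← map_mul, inv_mul_cancel_right]
  have hmk : (QuotientGroup.mk (Z * g) : GammaOne k K p) = QuotientGroup.mk g := by
    have hZ : Z ∈ scalarUnits k K p := ⟨z, rfl⟩
    rw [QuotientGroup.mk_mul, (QuotientGroup.eq_one_iff Z).2 hZ, one_mul]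
  have hcomm : scalarGL e * (scalarGL c * φ.toGL g)
      = scalarGL c * φ.toGL g * scalarGL (d := d) e := by
    ext1
    exact Algebra.commutes (e : LocalField hp) _
  obtain ⟨a, ha⟩ := φ.exists_const_of_integral (Z * g)
    (by
      rw [hZg]
      exact scalarGL_mul_mem_integralMatrices he (mem_of_stdLattice_smul_eq hc.symm))
    (by
      rw [map_inv, hZg, hcomm, mul_inv_rev]
      have : (scalarGL (d := d) e)⁻¹ = scalarGL e⁻¹ := (map_inv _ _).symm
      rw [this]
      exact scalarGL_mul_mem_integralMatrices he'
        (mem_of_stdLattice_smul_eq (inv_smul_eq_iff.2 hc)))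
  rw [← hmk] at hγ ⊢
  exact mk_eq_one_of_const hpt ha hγ

theorem simply_transitive (hpt : ¬ X ∣ p) (φ : LocalSplitting k K d hp)
    (x y : BuildingVertex (LocalRing hp) (LocalField hp) d) :
    ∃! γ : GammaTau k K hpt, φ.vertexAction γ x = y := by
  obtain ⟨a, ha, rfl⟩ := exists_gammaTau_smul_eq hpt φ x
  obtain ⟨b, hb, rfl⟩ := exists_gammaTau_smul_eq hpt φ y
  refine ⟨⟨b * a⁻¹, mul_mem hb (inv_mem ha)⟩, ?_, ?_⟩
  · change φ.vertexAction (b * a⁻¹) _ = _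
    rw [← Equiv.Perm.mul_apply, ← map_mul, inv_mul_cancel_right]
  · rintro ⟨γ, hγ⟩ h
    change φ.vertexAction γ _ = _ at h
    refine Subtype.ext ?_
    change γ = b * a⁻¹
    rw [eq_mul_inv_iff_mul_eq, ← inv_mul_eq_one, ← inv_eq_one, mul_inv_rev, inv_inv]
    -- Uniqueness: `b⁻¹ γ a` fixes the standard vertex.
    refine eq_one_of_smul_stdLattice hpt φ (mul_mem (inv_mem hb) (mul_mem hγ ha)) ?_
    rw [map_mul, map_mul, Equiv.Perm.mul_apply, Equiv.Perm.mul_apply, h, ← Equiv.Perm.mul_apply,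
      ← map_mul, inv_mul_cancel, map_one]
    rfl

end SimplyTransitive

end SkewBuilding

end

open SkewBuilding in
theorem corollary53 {k : Type*} [Field k] [Fintype k] {K : Type*} [Field K] [Algebra k K]
    [FiniteDimensional k K] (d : ℕ) (hd : Module.finrank k K = d)
    (p : k[X]) (hp : Irreducible p) (hpt : ¬ X ∣ p) :
    Nonempty (LocalSplitting k K d hp) ∧
    ∀ φ : LocalSplitting k K d hp,
      ∀ x y : BuildingVertex (LocalRing hp) (LocalField hp) d,
        ∃! γ : GammaTau k K hpt, φ.vertexAction γ x = y :=
  ⟨nonempty_localSplitting d hd hp hpt, fun φ x y => simply_transitive hpt φ x y⟩
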